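/- **Proposition (validity of the generic auxiliary algorithm).** Let $T,N\ge 1$, $\mathsf X=\mathbb R^D$, $[N]_0=\{0,\dots,N\}$, and let $$\pi_T(x_{1:T})\propto\prod_{t=1}^T Q_t(x_{t-1:t})$$ be a probability density on $\mathsf X^T$, where the $Q_t>0$ are measurable and the product is Lebesgue-integrable. Throughout, arguments with time index $\le 0$ and factors with time index $>T$ are ignored. For $t\le T$ let $\Phi_t\colon\mathsf X^T\to\mathsf X$ be measurable and let $E_t(x_{1:T})\in\mathbb R^{D\times D}$ be symmetric positive definite, measurable in $x_{1:T}$ (for example $\Phi_t(x_{1:T})=\phi_t(x_{t-1:t})+\psi_t(x_{t:t+1})$ and $E_t=E_t(x_{t-1:t})$). Put $$\pi'_T(x_{1:T},u_{1:T})=\pi_T(x_{1:T})\prod_{t=1}^T \mathrm N\big(u_t;\,x_t+\Phi_t(x_{1:T}),\,E_t(x_{1:T})\big),\qquad u_{1:T}\in\mathsf X^T .$$ Let $M'_t(x_t\mid x_{t-1};u_{1:T})\ge 0$ be mutation kernels (probability densities in $x_t$ with respect to Lebesgue measure) and $G'_t(x_{t-2:t};u_{1:T})>0$ potential functions, jointly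 measurable in all arguments, and put $Q'_t(x_{t-2:t};u_{1:T})=M'_t(x_t\mid x_{t-1};u_{1:T})\,G'_t(x_{t-2:t};u_{1:T})$. Assume that for every $u_{1:T}$, as functions of $x_{1:T}\in\mathsf X^T$, $$\pi'_T(x_{1:T}\mid u_{1:T})\propto \pi'_T(x_{1:T},u_{1:T})\propto\prod_{t=1}^T Q'_t(x_{t-2:t};u_{1:T})$$ (with a finite, strictly positive constant of proportionality that may depend on $u_{1:T}$). Given a reference path $x_{1:T}\in\mathsf X^T$, the generic auxiliary algorithm produces $\tilde x_{1:T}$ as follows. Sample $u_t\sim \mathrm N(x_t+\Phi_t(x_{1:T}),E_t(x_{1:T}))$ independently for $t=1,\dots,T$. Then: 1. For $t=1,\dots,T$: sample $k_t$ uniformly on $[N]_0$ and set $x_t^{k_t}=x_t$. If $t>1$, set $a_{t-1}^{k_t}=k_{t-1}$ and, for $n\ne k_t$, sample independently $a_{t-1}^n=i$ with probability $W_{t-1}^i$. For $n\neq k_t$, sample independently $x_t^n\sim M'_t(\,\cdot\mid x_{t-1}^{a_{t-1}^n};u_{1:T})$. For all $n\in[N]_0$, set $w_t^n=G'_t(x_{t-2:t}^{(n)};u_{1:T})$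 and $W_t^n=w_t^n/\sum_{m=0}^N w_t^m$, where the lineages are defined by $x_{1:t}^{(n)}=(x_{1:t-1}^{(a_{t-1}^n)},x_t^n)$. 2. Sample $i\in[N]_0\setminus\{k_T\}$ with probability $W_T^i/(1-W_T^{k_T})$; set $l_T=i$ with probability $1\wedge\frac{1-W_T^{k_T}}{1-W_T^i}$, and otherwise set $l_T=k_T$. 3. For $t=T-1,\dots,1$: sample $l_t=i\in[N]_0$ with probability proportional to $$W_t^i\;Q'_{t+1}\big((x_{t-1:t}^{(i)},x_{t+1}^{l_{t+1}});u_{1:T}\big)\;Q'_{t+2}\big((x_t^i,x_{t+1}^{l_{t+1}},x_{t+2}^{l_{t+2}});u_{1:T}\big).$$ 4. Return $\tilde x_{1:T}=(x_1^{l_1},\dots,x_T^{l_T})$. Then sampling $\tilde x_{1:T}$ given $x_{1:T}$ by this algorithm induces a Markov kernel $P(\tilde x_{1:T}\mid x_{1:T})$ on $\mathsf X^T$ which leaves $\pi_T$ invariant. -/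

import Mathlib

open MeasureTheory ProbabilityTheory
open scoped Matrix

noncomputable section

namespace AuxCSMC

/-- The state space `ℝ^D`. -/
abbrev Pt (D : ℕ) : Type := EuclideanSpace ℝ (Fin D)

/-! ### Time indices

The times `1, …, T` are the elements of `Fin T` (so the first time is `0 : Fin T`). States whose time
index lies before the first time are to be ignored: they are replaced by the dummy value `0`, so that
a function of `(x_{t-2}, x_{t-1}, x_t)` is, at the first time, a function of the last argument only, and
at the second time a function of the last two arguments only. -/

/-- The preceding time `t - 1`. -/
def before {T : ℕ} (t : Fin T) : Fin T := ⟨t.val - 1, lt_of_le_of_lt (Nat.sub_le _ _) t.isLt⟩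

/-- The state `x_{t-1}` of a path (a dummy if there is no time `t - 1`). -/
def lag1 {T D : ℕ} (x : Fin T → Pt D) (t : Fin T) : Pt D :=
  if 1 ≤ t.val then x (before t) else 0

/-- The state `x_{t-2}` of a path (a dummy if there is no time `t - 2`). -/
def lag2 {T D : ℕ} (x : Fin T → Pt D) (t : Fin T) : Pt D :=
  if 2 ≤ t.val then x (before (before t)) else 0

/-! ### The target distribution -/

/-- The unnormalised density `∏_t Q_t(x_{t-1:t})`. -/
def unnormDensity {T D : ℕ} (Q : Fin T → Pt D → Pt D → ℝ) (x : Fin T → Pt D) : ℝ :=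
  ∏ t, Q t (lag1 x t) (x t)

/-- The density of the joint smoothing distribution `π_T` with respect to Lebesgue measure. -/
def targetDensity {T D : ℕ} (Q : Fin T → Pt D → Pt D → ℝ) (x : Fin T → Pt D) : ℝ :=
  unnormDensity Q x / ∫ z, unnormDensity Q z

/-- The joint smoothing distribution `π_T`. -/
def target {T D : ℕ} (Q : Fin T → Pt D → Pt D → ℝ) : Measure (Fin T → Pt D) :=
  volume.withDensity fun x => ENNReal.ofReal (targetDensity Q x)

/-- The Lebesgue density `N(z; m, S)` of the Gaussian distribution with mean `m` and
positive-definite covariance matrix `S`. -/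
def gaussianDensity {D : ℕ} (m : Pt D) (S : Matrix (Fin D) (Fin D) ℝ) (z : Pt D) : ℝ :=
  (Real.sqrt ((2 * Real.pi) ^ D * S.det))⁻¹ *
    Real.exp (-(1 / 2) * ((fun i => z i - m i) ⬝ᵥ (S⁻¹ *ᵥ fun i => z i - m i)))

/-- The density
`π'_T(x_{1:T}, u_{1:T}) = π_T(x_{1:T}) ∏_t N(u_t; x_t + Φ_t(x_{1:T}), E_t(x_{1:T}))`
of the extended target distribution. -/
def extendedDensity {T D : ℕ} (Q : Fin T → Pt D → Pt D → ℝ)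
    (Φ : Fin T → (Fin T → Pt D) → Pt D)
    (E : Fin T → (Fin T → Pt D) → Matrix (Fin D) (Fin D) ℝ)
    (x u : Fin T → Pt D) : ℝ :=
  targetDensity Q x * ∏ t, gaussianDensity (x t + Φ t x) (E t x) (u t)

/-- The law of the auxiliary variables: independent `u_t ∼ N(x_t + Φ_t(x_{1:T}), E_t(x_{1:T}))`. -/
def auxLaw {T D : ℕ} (Φ : Fin T → (Fin T → Pt D) → Pt D)
    (E : Fin T → (Fin T → Pt D) → Matrix (Fin D) (Fin D) ℝ)
    (x : Fin T → Pt D) : Measure (Fin T → Pt D) :=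
  Measure.pi fun t => multivariateGaussian (x t + Φ t x) (E t x)

/-! ### Conditional sequential Monte Carlo for a second-order Markov model

Throughout, `M t x₁ x₂` stands for the mutation density `M_t(x₂ | x₁)` and `G t x₀ x₁ x₂` for the
potential `G_t(x_{t-2:t})` with `(x_{t-2}, x_{t-1}, x_t) = (x₀, x₁, x₂)`. -/

/-- `Q_t(x_{t-2:t}) = M_t(x_t | x_{t-1}) G_t(x_{t-2:t})`. -/
def stepDensity {T D : ℕ} (M : Fin T → Pt D → Pt D → ℝ) (G : Fin T → Pt D → Pt D → Pt D → ℝ)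
    (t : Fin T) (x₀ x₁ x₂ : Pt D) : ℝ :=
  M t x₁ x₂ * G t x₀ x₁ x₂

/-- The mutation kernel `M_t(· | x₁)` as a measure. -/
def mutationLaw {T D : ℕ} (M : Fin T → Pt D → Pt D → ℝ) (t : Fin T) (x₁ : Pt D) :
    Measure (Pt D) :=
  volume.withDensity fun z => ENNReal.ofReal (M t x₁ z)

/-- The law of a random index that equals `i` with probability `p i`. -/
def categorical {N : ℕ} (p : Fin (N + 1) → ℝ) : Measure (Fin (N + 1)) :=
  ∑ i, ENNReal.ofReal (p i) • Measure.dirac i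

/-- Normalisation of a vector of weights. -/
def normalise {N : ℕ} (w : Fin (N + 1) → ℝ) (n : Fin (N + 1)) : ℝ :=
  w n / ∑ m, w m

/-- A particle system: `(S t n).2` is the `n`th particle `x_t^n` at time `t`, and `(S t n).1` is the
index `a_{t-1}^n` of its ancestor at time `t - 1` (a dummy at the first time). -/
abbrev Particles (T D N : ℕ) : Type := Fin T → Fin (N + 1) → Fin (N + 1) × Pt D

/-- `x_{t-1}^{(n)}`, the state at time `t - 1` of the lineage that ends in particle `n` at time `t`. -/
def parent {T D N : ℕ} (S : Particles T D N) (t : Fin T) (n : Fin (N + 1)) : Pt D :=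
  if 1 ≤ t.val then (S (before t) (S t n).1).2 else 0

/-- `x_{t-2}^{(n)}`, the state at time `t - 2` of the lineage that ends in particle `n` at time `t`. -/
def grandparent {T D N : ℕ} (S : Particles T D N) (t : Fin T) (n : Fin (N + 1)) : Pt D :=
  if 1 ≤ t.val then parent S (before t) (S t n).1 else 0

/-- The normalised weight `W_t^n`, where `w_t^n = G_t(x_{t-2:t}^{(n)})`. -/
def weight {T D N : ℕ} (G : Fin T → Pt D → Pt D → Pt D → ℝ) (S : Particles T D N)
    (t : Fin T) (n : Fin (N + 1)) : ℝ :=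
  normalise (fun m => G t (grandparent S t m) (parent S t m) (S t m).2) n

/-- The law of the pair `(a_{t-1}^n, x_t^n)` for a particle that is not the reference particle:
`a_{t-1}^n = i` with probability `W_{t-1}^i`, then `x_t^n ∼ M_t(· | x_{t-1}^{a_{t-1}^n})`. -/
def proposalLaw {T D N : ℕ} (M : Fin T → Pt D → Pt D → ℝ) (G : Fin T → Pt D → Pt D → Pt D → ℝ)
    (S : Particles T D N) (t : Fin T) : Measure (Fin (N + 1) × Pt D) :=
  if 1 ≤ t.val then
    (categorical (weight G S (before t))).bind fun i =>
      (mutationLaw M t (S (before t) i).2).map (Prod.mk i)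
  else (mutationLaw M t 0).map (Prod.mk 0)

/-- Step `t` of the forward pass, on pairs of the reference indices `k` and the particle system `S`
(of which only the entries at times before `t` have been sampled so far): sample `k_t` uniformly, put
the reference state `x_t` with ancestor index `k_{t-1}` at position `k_t`, and sample the remaining
particles independently. -/
def forwardStep {T D N : ℕ} (M : Fin T → Pt D → Pt D → ℝ) (G : Fin T → Pt D → Pt D → Pt D → ℝ)
    (x : Fin T → Pt D) (t : Fin T) (s : (Fin T → Fin (N + 1)) × Particles T D N) :
    Measure ((Fin T → Fin (N + 1)) × Particles T D N) :=
  (categorical fun _ : Fin (N + 1) => 1 / ((N : ℝ) + 1)).bind fun j =>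
    (Measure.pi fun n : Fin (N + 1) =>
      if n = j then Measure.dirac (if 1 ≤ t.val then s.1 (before t) else 0, x t)
      else proposalLaw M G s.2 t).map fun g =>
        (Function.update s.1 t j, Function.update s.2 t g)

/-- The law of the reference indices and the particle system after the forward pass, which runs
through the times in increasing order (the initial values are overwritten). -/
def forwardLaw {T D : ℕ} (N : ℕ) (M : Fin T → Pt D → Pt D → ℝ)
    (G : Fin T → Pt D → Pt D → Pt D → ℝ) (x : Fin T → Pt D) :
    Measure ((Fin T → Fin (N + 1)) × Particles T D N) :=
  (List.finRange T).foldl (fun μ t => μ.bind (forwardStep M G x t)) (Measure.dirac (0, 0))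

/-- The forced move from index `k` for the probabilities `W`: sample `i ≠ k` with probability
`W^i / (1 - W^k)`, return `i` with probability `1 ∧ (1 - W^k) / (1 - W^i)` and otherwise `k`. -/
def forcedMove {N : ℕ} (W : Fin (N + 1) → ℝ) (k : Fin (N + 1)) : Measure (Fin (N + 1)) :=
  (categorical fun i => if i = k then 0 else W i / (1 - W k)).bind fun i =>
    ENNReal.ofReal (min 1 ((1 - W k) / (1 - W i))) • Measure.dirac i +
      ENNReal.ofReal (1 - min 1 ((1 - W k) / (1 - W i))) • Measure.dirac k

/-- The backward-sampling weight of index `i` at a time `t` before the last one, given the indices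
`l_{t+1}, l_{t+2}`:
`W_t^i Q_{t+1}(x_{t-1:t}^{(i)}, x_{t+1}^{l_{t+1}}) Q_{t+2}(x_t^i, x_{t+1}^{l_{t+1}}, x_{t+2}^{l_{t+2}})`,
without the last factor if there is no time `t + 2`. -/
def backwardWeight {T D N : ℕ} (M : Fin T → Pt D → Pt D → ℝ)
    (G : Fin T → Pt D → Pt D → Pt D → ℝ) (S : Particles T D N) (l : Fin T → Fin (N + 1))
    (t : Fin T) (h1 : t.val + 1 < T) (i : Fin (N + 1)) : ℝ :=
  weight G S t i *
    stepDensity M G ⟨t.val + 1, h1⟩ (parent S t i) (S t i).2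
      (S ⟨t.val + 1, h1⟩ (l ⟨t.val + 1, h1⟩)).2 *
    if h2 : t.val + 2 < T then
      stepDensity M G ⟨t.val + 2, h2⟩ (S t i).2 (S ⟨t.val + 1, h1⟩ (l ⟨t.val + 1, h1⟩)).2
        (S ⟨t.val + 2, h2⟩ (l ⟨t.val + 2, h2⟩)).2
    else 1

/-- The law of `l_t` given `l_{t+1}, …, l_T`: a forced move from the reference index `k_T` at the last
time, backward sampling at the other times. -/
def indexLaw {T D N : ℕ} (M : Fin T → Pt D → Pt D → ℝ) (G : Fin T → Pt D → Pt D → Pt D → ℝ)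
    (k : Fin T → Fin (N + 1)) (S : Particles T D N) (t : Fin T) (l : Fin T → Fin (N + 1)) :
    Measure (Fin (N + 1)) :=
  if h1 : t.val + 1 < T then categorical (normalise (backwardWeight M G S l t h1))
  else forcedMove (weight G S t) (k t)

/-- The law of the indices `l_1, …, l_T`, which are sampled in the order `l_T, l_{T-1}, …, l_1` (the
initial values are overwritten). -/
def backwardLaw {T D N : ℕ} (M : Fin T → Pt D → Pt D → ℝ) (G : Fin T → Pt D → Pt D → Pt D → ℝ)
    (s : (Fin T → Fin (N + 1)) × Particles T D N) : Measure (Fin T → Fin (N + 1)) :=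
  (List.finRange T).reverse.foldl
    (fun μ t => μ.bind fun l => (indexLaw M G s.1 s.2 t l).map fun i => Function.update l t i)
    (Measure.dirac 0)

/-- The law of the new path `(x_1^{l_1}, …, x_T^{l_T})` produced by conditional sequential Monte Carlo
with backward sampling from the reference path `x`. -/
def csmcLaw {T D : ℕ} (N : ℕ) (M : Fin T → Pt D → Pt D → ℝ)
    (G : Fin T → Pt D → Pt D → Pt D → ℝ) (x : Fin T → Pt D) : Measure (Fin T → Pt D) :=
  (forwardLaw N M G x).bind fun s => (backwardLaw M G s).map fun l t => (s.2 t (l t)).2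

/-- The law of the output of the generic auxiliary algorithm given the path `x`: sample the auxiliary
variables `u` given `x`, then run conditional sequential Monte Carlo from the reference path `x` with
the mutation densities `M u` and the potentials `G u`. -/
def auxiliaryLaw {T D : ℕ} (N : ℕ) (Φ : Fin T → (Fin T → Pt D) → Pt D)
    (E : Fin T → (Fin T → Pt D) → Matrix (Fin D) (Fin D) ℝ)
    (M : (Fin T → Pt D) → Fin T → Pt D → Pt D → ℝ)
    (G : (Fin T → Pt D) → Fin T → Pt D → Pt D → Pt D → ℝ)
    (x : Fin T → Pt D) : Measure (Fin T → Pt D) :=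
  (auxLaw Φ E x).bind fun u => csmcLaw N (M u) (G u) x

end AuxCSMC

end

/-! The algorithm is a Gibbs step on an extended space. Drawing `u` given `x ∼ π_T` produces the
joint density `π'_T(x, u)`. For frozen `u`, conditional SMC leaves `x ↦ π'_T(x, u) ∝ ∏ Q'_t`
invariant, so two uses of Tonelli give invariance of the marginal `π_T`
(`lintegral_target_auxiliaryLaw`).

For frozen `u` the claim is `lintegral_pathDensity_mul_csmcLaw`. No joint law of all particles and
all indices is written down. Both sides are compared instead with `particleExpectation`, an
expectation over the unconditional particle system weighted by the product of its mean weights.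

The engine is the many-to-one formula `particleStep_sum_weight`. The mean weight times `W^j` is `G^j
/ (N + 1)`, so normalisation disappears. The particle `j` may then be drawn first and the rest of
its generation independently of it. Its ancestor is drawn from the previous weights and its state
from `M`, so `M G = Q'` appears, and what remains is a generation forced to contain a given particle
at a uniform position: a step of the conditional forward pass.

Iterated, this gives `lmarginal_forwardPrefix`: a reference path weighted by `∏ Q'_t`, followed by
the conditional forward pass, amounts to the weighted unconditional system with `k_T` drawn from
`W_T`. The earlier reference indices are averaged out, which is harmless since the selection of the
new path sees only `k_T` (`lintegral_backwardLaw`). The forced move is reversible for `W_T`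
(`sum_forcedMove`), so `l_T` is also drawn from `W_T`.

For the backward pass, consider the particles before time `n`, a lineage drawn from the last
weights, and the integral over all states from `n` on of their density times the value of the
remaining backward pass. The expectation of this does not depend on `n`
(`particleExpectation_futureIntegral`): at `n = T` it is the expected output of the algorithm, at `n
= 0` it is the target integral. In the step from `t + 1` to `t`, the backward weights are `W_t^i`
times the whole future density, up to factors free of `i` (`normalise_backwardWeight`). Their
normalising constant therefore cancels against the sum over lineages (`sum_futureIntegral_succ`),
and the many-to-one formula integrates out generation `t`. -/

noncomputable section

namespace AuxCSMC

/-! ### Measurable families of probability measures -/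

section Families

variable {α β γ ι : Type*} [MeasurableSpace α] [MeasurableSpace β] [MeasurableSpace γ]

/-- A measurable family of probability measures. -/
structure MarkovFamily (κ : α → Measure β) : Prop where
  measurable : Measurable κ
  isProb : ∀ a, IsProbabilityMeasure (κ a)

namespace MarkovFamily

/-- The Markov kernel given by a measurable family of probability measures. -/
def kernel {κ : α → Measure β} (h : MarkovFamily κ) : Kernel α β := ⟨κ, h.measurable⟩

theorem isMarkovKernel {κ : α → Measure β} (h : MarkovFamily κ) : IsMarkovKernel h.kernel :=
  ⟨h.isProb⟩

theorem comp {κ : β → Measure γ} (h : MarkovFamily κ) {f : α → β} (hf : Measurable f) :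
    MarkovFamily fun a => κ (f a) :=
  ⟨h.measurable.comp hf, fun a => h.isProb (f a)⟩

theorem measurable_lintegral {κ : α → Measure β} (h : MarkovFamily κ) {f : α → β → ENNReal}
    (hf : Measurable (Function.uncurry f)) : Measurable fun a => ∫⁻ b, f a b ∂κ a := by
  have := h.isMarkovKernel
  exact Measurable.lintegral_kernel_prod_right (κ := h.kernel) hf

theorem bind {μ : α → Measure β} {κ : α → β → Measure γ} (hμ : MarkovFamily μ)
    (hκ : MarkovFamily (Function.uncurry κ)) : MarkovFamily fun a => (μ a).bind (κ a) := by
  have hm : ∀ a, Measurable (κ a) := fun a => hκ.measurable.comp measurable_prodMk_left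
  refine ⟨Measure.measurable_of_measurable_coe _ fun s hs => ?_, fun a => ⟨?_⟩⟩
  · simp_rw [Measure.bind_apply hs (hm _).aemeasurable]
    exact hμ.measurable_lintegral ((Measure.measurable_coe hs).comp hκ.measurable)
  · rw [Measure.bind_apply .univ (hm a).aemeasurable]
    have := hμ.isProb a
    have : ∀ b, κ a b Set.univ = 1 := fun b => (hκ.isProb (a, b)).measure_univ
    simp [this]

theorem dirac {f : α → β} (hf : Measurable f) : MarkovFamily fun a => Measure.dirac (f a) :=
  ⟨Measure.measurable_dirac.comp hf, fun _ => inferInstance⟩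

theorem map {μ : α → Measure β} (hμ : MarkovFamily μ) {f : α → β → γ}
    (hf : Measurable (Function.uncurry f)) : MarkovFamily fun a => (μ a).map (f a) := by
  have h := hμ.bind (κ := fun a b => Measure.dirac (f a b)) (dirac hf)
  -- The map itself varies with the parameter, so the pushforward is written as a `bind` with point
  -- masses.
  have e : ∀ a, (μ a).map (f a) = (μ a).bind fun b => Measure.dirac (f a b) := fun a =>
    (Measure.bind_dirac_eq_map _ (hf.comp measurable_prodMk_left)).symm
  simp_rw [e]
  exact h

/-- Measurability need only be tested on boxes, a π-system on which the product measure is a finite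
product of measurable functions of the parameter. -/
theorem pi [Fintype ι] {κ : ι → α → Measure β} (h : ∀ i, MarkovFamily (κ i)) :
    MarkovFamily fun a => Measure.pi fun i => κ i a := by
  have : ∀ i a, IsProbabilityMeasure (κ i a) := fun i a => (h i).isProb a
  refine ⟨Measurable.measure_of_isPiSystem_of_isProbabilityMeasure generateFrom_pi.symm
    isPiSystem_pi ?_, fun a => inferInstance⟩
  rintro _ ⟨s, hs, rfl⟩
  simp_rw [Measure.pi_pi]
  exact Finset.measurable_prod _ fun i _ =>
    (Measure.measurable_coe (hs i (Set.mem_univ i))).comp (h i).measurable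

theorem ite {p : α → Prop} [DecidablePred p] (hp : MeasurableSet {a | p a}) {κ η : α → Measure β}
    (hκ : MarkovFamily κ) (hη : MarkovFamily η) :
    MarkovFamily fun a => if p a then κ a else η a :=
  ⟨Measurable.ite hp hκ.measurable hη.measurable, fun a => by
    have := hκ.isProb a
    have := hη.isProb a
    split_ifs <;> infer_instance⟩

/-- This is the shape of one generation in the conditional forward pass: the reference particle `r
a` at position `j a`, independent proposals elsewhere. -/
theorem pi_replace [Fintype ι] [DecidableEq ι] [MeasurableSpace ι] [MeasurableSingletonClass ι]
    [Countable ι] {κ : α → Measure β} (hκ : MarkovFamily κ) {r : α → β} (hr : Measurable r)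
    {j : α → ι} (hj : Measurable j) :
    MarkovFamily fun a => Measure.pi fun n : ι => if n = j a then Measure.dirac (r a) else κ a :=
  MarkovFamily.pi fun _ => MarkovFamily.ite (measurableSet_eq_fun measurable_const hj)
    (MarkovFamily.dirac hr) hκ

end MarkovFamily

theorem lintegral_categorical {N : ℕ} (p : Fin (N + 1) → ℝ) (f : Fin (N + 1) → ENNReal) :
    ∫⁻ i, f i ∂categorical p = ∑ i, ENNReal.ofReal (p i) * f i := by
  simp [categorical, lintegral_finsetSum_measure]

theorem MarkovFamily.categorical {N : ℕ} {p : α → Fin (N + 1) → ℝ} (hp : Measurable p)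
    (h0 : ∀ a i, 0 ≤ p a i) (h1 : ∀ a, ∑ i, p a i = 1) :
    MarkovFamily fun a => categorical (p a) := by
  refine ⟨Measure.measurable_of_measurable_coe _ fun s hs => ?_, fun a => ⟨?_⟩⟩
  · simp_rw [← lintegral_indicator_one hs, lintegral_categorical]
    exact Finset.measurable_sum _ fun i _ =>
      (((measurable_pi_apply i).comp hp).ennreal_ofReal).mul_const _
  · rw [← lintegral_one, lintegral_categorical]
    simp [← ENNReal.ofReal_sum_of_nonneg fun i _ => h0 a i, h1 a]

/-- Evaluation at a random index is measurable. -/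
theorem measurable_eval_index [Countable ι] [MeasurableSpace ι] [MeasurableSingletonClass ι]
    {f : α → ι → β} (hf : Measurable f) {i : α → ι} (hi : Measurable i) :
    Measurable fun a => f a (i a) := by
  have : Measurable fun p : α × ι => f p.1 p.2 :=
    measurable_from_prod_countable_left fun j => (measurable_pi_apply j).comp hf
  exact this.comp (measurable_id.prodMk hi)

/-- Redrawing one coordinate of a product measure from its marginal does not change it. -/
theorem lintegral_pi_replace [Fintype ι] [DecidableEq ι] [MeasurableSingletonClass β]
    (μ : Measure β) [IsProbabilityMeasure μ] (j : ι) {h : β → (ι → β) → ENNReal} (hh : Measurable (Function.uncurry h)) :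
    ∫⁻ z, ∫⁻ g, h z g ∂(Measure.pi fun n => if n = j then Measure.dirac z else μ) ∂μ =
      ∫⁻ g, h (g j) g ∂Measure.pi fun _ : ι => μ := by
  have hfam : ∀ n : ι, MarkovFamily fun z : β => if n = j then Measure.dirac z else μ := fun n => by
    by_cases hn : n = j
    · simpa [hn] using MarkovFamily.dirac measurable_id
    · simpa [hn] using ⟨measurable_const, fun _ => inferInstance⟩
  have : ∀ n z, IsProbabilityMeasure (if n = j then Measure.dirac z else μ) := fun n z =>
    (hfam n).isProb z
  have hpi := MarkovFamily.pi hfam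
  -- Averaging the point mass over `μ` restores `μ` in the factor `j`; this is checked on boxes.
  have hb : μ.bind (fun z => Measure.pi fun n => if n = j then Measure.dirac z else μ) =
      Measure.pi fun _ : ι => μ := by
    refine (Measure.pi_eq fun s hs => ?_).symm
    rw [Measure.bind_apply (.univ_pi hs) hpi.measurable.aemeasurable]
    simp_rw [Measure.pi_pi, ← Finset.mul_prod_erase _ _ (Finset.mem_univ j)]
    have : ∀ z, ∏ n ∈ Finset.univ.erase j, (if n = j then Measure.dirac z else μ) (s n) =
        ∏ n ∈ Finset.univ.erase j, μ (s n) := fun z =>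
      Finset.prod_congr rfl fun n hn => by rw [if_neg (Finset.ne_of_mem_erase hn)]
    simp_rw [this, if_true]
    simp_rw [Measure.dirac_apply' _ (hs j)]
    rw [lintegral_mul_const _ (measurable_one.indicator (hs j)), lintegral_indicator_one (hs j)]
  have hm : Measurable fun g : ι → β => h (g j) g :=
    show Measurable fun g : ι → β => Function.uncurry h (g j, g) from
      hh.comp ((measurable_pi_apply j).prodMk measurable_id)
  rw [← hb, Measure.lintegral_bind hpi.measurable.aemeasurable hm.aemeasurable]
  refine lintegral_congr fun z => lintegral_congr_ae ?_
  have : ∀ n, SigmaFinite (if n = j then Measure.dirac z else μ) := fun n => inferInstance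
  -- The factor `j` is a point mass at `z`, so `g j = z` almost surely and `h z g` may replace `h (g
  -- j) g`.
  have hz := (measurePreserving_eval (fun n => if n = j then Measure.dirac z else μ)
    j).quasiMeasurePreserving.ae (p := fun w => w = z) (by simp [ae_dirac_eq])
  filter_upwards [hz] with g hg
  rw [show g j = z from hg]

end Families

/-! ### Gaussian densities -/

section Gaussian

/-- Tonelli, one coordinate at a time: the induction is over the set of coordinates already
integrated, through `lmarginal`. -/
theorem lintegral_prod_pi {ι : Type*} [Fintype ι] {X : ι → Type*} [∀ i, MeasurableSpace (X i)]
    (μ : ∀ i, Measure (X i)) [∀ i, SigmaFinite (μ i)] {f : ∀ i, X i → ENNReal}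
    (hf : ∀ i, Measurable (f i)) :
    ∫⁻ x, ∏ i, f i (x i) ∂Measure.pi μ = ∏ i, ∫⁻ z, f i z ∂μ i := by
  classical
  have hm : ∀ s : Finset ι, Measurable fun x : ∀ i, X i => ∏ i ∈ s, f i (x i) := fun s =>
    Finset.measurable_prod _ fun i _ => (hf i).comp (measurable_pi_apply i)
  have key : ∀ (s : Finset ι) (x : ∀ i, X i),
      lmarginal μ s (fun x => ∏ i ∈ s, f i (x i)) x = ∏ i ∈ s, ∫⁻ z, f i z ∂μ i := by
    intro s
    induction s using Finset.induction with
    | empty => simp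
    | insert a s ha ih =>
      intro x
      rw [lmarginal_insert' _ (hm _) ha, Finset.prod_insert ha, ← ih x, lmarginal, lmarginal,
        ← lintegral_const_mul (f := fun y => ∏ i ∈ s, f i (Function.updateFinset x s y i)) _
          ((hm s).comp measurable_updateFinset)]
      refine lintegral_congr fun y => ?_
      rw [← lintegral_mul_const _ (hf a)]
      refine lintegral_congr fun z => ?_
      rw [Finset.prod_insert ha, Function.update_self]
      congr 1
      exact Finset.prod_congr rfl fun i hi =>
        by rw [Function.update_of_ne (ne_of_mem_of_not_mem hi ha)]
  -- `lmarginal` needs a base point. If there is none, some factor space is empty and both sides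
  -- vanish.
  by_cases hne : Nonempty (∀ i, X i)
  · obtain ⟨x⟩ := hne
    rw [lintegral_eq_lmarginal_univ x, key]
  · rw [not_nonempty_iff] at hne
    rw [lintegral_of_isEmpty]
    obtain ⟨i, hi⟩ := isEmpty_pi.mp hne
    rw [Finset.prod_eq_zero (Finset.mem_univ i)]
    rw [lintegral_of_isEmpty]

/-- On a box, the indicator is the product of the indicators of its sides, so `lintegral_prod_pi`
factorises the integral. -/
theorem pi_withDensity {ι : Type*} [Fintype ι] {X : ι → Type*} [∀ i, MeasurableSpace (X i)]
    (μ : ∀ i, Measure (X i)) [∀ i, SigmaFinite (μ i)] {f : ∀ i, X i → ENNReal}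
    (hf : ∀ i, Measurable (f i)) [∀ i, SigmaFinite ((μ i).withDensity (f i))] :
    Measure.pi (fun i => (μ i).withDensity (f i)) =
      (Measure.pi μ).withDensity fun x => ∏ i, f i (x i) := by
  refine Measure.pi_eq fun s hs => ?_
  rw [withDensity_apply _ (.univ_pi hs), ← lintegral_indicator (.univ_pi hs)]
  simp_rw [withDensity_apply _ (hs _), ← lintegral_indicator (hs _)]
  rw [← lintegral_prod_pi μ fun i => (hf i).indicator (hs i)]
  refine lintegral_congr fun x => ?_
  classical
  by_cases hx : x ∈ Set.univ.pi s
  · rw [Set.indicator_of_mem hx]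
    exact Finset.prod_congr rfl fun i _ => by rw [Set.indicator_of_mem (hx i (Set.mem_univ i))]
  · rw [Set.indicator_of_notMem hx]
    simp only [Set.mem_pi, Set.mem_univ, true_implies, not_forall] at hx
    obtain ⟨i, hi⟩ := hx
    rw [Finset.prod_eq_zero (Finset.mem_univ i)]
    rw [Set.indicator_of_notMem hi]

theorem map_withDensity_comp {α β : Type*} [MeasurableSpace α] [MeasurableSpace β]
    {μ : Measure α} {g : α → β} (hg : Measurable g) {f : β → ENNReal} (hf : Measurable f) :
    (μ.withDensity (f ∘ g)).map g = (μ.map g).withDensity f := by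
  ext s hs
  rw [Measure.map_apply hg hs, withDensity_apply _ (hg hs), withDensity_apply _ hs,
    setLIntegral_map hs hf hg]
  rfl

theorem stdGaussian_eq_withDensity (D : ℕ) :
    stdGaussian (Pt D) = volume.withDensity fun z => ENNReal.ofReal
      ((Real.sqrt ((2 * Real.pi) ^ D))⁻¹ * Real.exp (-(1 / 2) * ∑ i, z i ^ 2)) := by
  have h1 : Measure.pi (fun _ : Fin D => gaussianReal 0 1) =
      volume.withDensity fun x => ∏ i : Fin D, gaussianPDF 0 1 (x i) := by
    have e := gaussianReal_of_var_ne_zero 0 (one_ne_zero (α := NNReal))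
    have h : SigmaFinite ((volume : Measure ℝ).withDensity (gaussianPDF 0 1)) :=
      e ▸ inferInstance
    have : ∀ i : Fin D, SigmaFinite ((volume : Measure ℝ).withDensity (gaussianPDF 0 1)) :=
      fun _ => h
    rw [e, pi_withDensity (fun _ : Fin D => (volume : Measure ℝ))
      fun _ => measurable_gaussianPDF 0 1]
    rfl
  have h2 : (fun x : Fin D → ℝ => ∏ i : Fin D, gaussianPDF 0 1 (x i)) =
      (fun z : Pt D => ENNReal.ofReal ((Real.sqrt ((2 * Real.pi) ^ D))⁻¹ *
        Real.exp (-(1 / 2) * ∑ i, z i ^ 2))) ∘ WithLp.toLp 2 := by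
    ext x
    simp only [gaussianPDF, Function.comp_apply]
    rw [← ENNReal.ofReal_prod_of_nonneg fun i _ => gaussianPDFReal_nonneg 0 1 _]
    congr 1
    simp only [gaussianPDFReal, NNReal.coe_one, mul_one, sub_zero, Finset.prod_mul_distrib,
      Finset.prod_const, Finset.card_univ, Fintype.card_fin, ← Real.exp_sum]
    rw [Finset.mul_sum, inv_pow, Real.sqrt_eq_rpow, Real.sqrt_eq_rpow, ← Real.rpow_natCast,
      ← Real.rpow_natCast, ← Real.rpow_mul (by positivity), ← Real.rpow_mul (by positivity),
      mul_comm (1 / 2 : ℝ)]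
    congr 2
    refine Finset.sum_congr rfl fun i _ => by ring
  rw [← map_pi_eq_stdGaussian, h1, h2, map_withDensity_comp (by fun_prop) (by fun_prop),
    (PiLp.volume_preserving_toLp (Fin D)).map_eq]

theorem gaussianDensity_pos {D : ℕ} (m : Pt D) {S : Matrix (Fin D) (Fin D) ℝ} (hS : S.PosDef)
    (z : Pt D) : 0 < gaussianDensity m S z := by
  have := hS.det_pos
  unfold gaussianDensity
  positivity

/-! ### Measurability of the Gaussian density in mean, covariance and point -/

theorem measurable_det {α : Type*} [MeasurableSpace α] {D : ℕ}
    {S : α → Matrix (Fin D) (Fin D) ℝ} (hS : ∀ i j, Measurable fun a => S a i j) :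
    Measurable fun a => (S a).det := by
  simp_rw [Matrix.det_apply']
  exact Finset.measurable_sum _ fun σ _ =>
    (Finset.measurable_prod _ fun i _ => hS _ _).const_mul _

theorem measurable_matrix_inv {α : Type*} [MeasurableSpace α] {D : ℕ}
    {S : α → Matrix (Fin D) (Fin D) ℝ} (hS : ∀ i j, Measurable fun a => S a i j) (i j : Fin D) :
    Measurable fun a => (S a)⁻¹ i j := by
  simp_rw [Matrix.inv_def, Matrix.smul_apply, smul_eq_mul, Ring.inverse_eq_inv',
    Matrix.adjugate_apply]
  refine (measurable_det hS).inv.mul (measurable_det fun k l => ?_)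
  simp_rw [Matrix.updateRow_apply]
  split_ifs
  · exact measurable_const
  · exact hS k l

theorem measurable_gaussianDensity {α : Type*} [MeasurableSpace α] {D : ℕ} {m : α → Pt D}
    {S : α → Matrix (Fin D) (Fin D) ℝ} {z : α → Pt D} (hm : Measurable m)
    (hS : ∀ i j, Measurable fun a => S a i j) (hz : Measurable z) :
    Measurable fun a => gaussianDensity (m a) (S a) (z a) := by
  have h1 := measurable_det hS
  have h2 := measurable_matrix_inv hS
  have h3 : ∀ i, Measurable fun a => z a i - m a i := fun i =>
    Measurable.sub (by fun_prop) (by fun_prop)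
  have h4 : Measurable fun a =>
      (fun i => z a i - m a i) ⬝ᵥ ((S a)⁻¹ *ᵥ fun i => z a i - m a i) := by
    simp only [dotProduct, Matrix.mulVec]
    exact Finset.measurable_sum _ fun i _ => (h3 i).mul
      (Finset.measurable_sum _ fun j _ => (h2 i j).mul (h3 j))
  exact ((h1.const_mul _).sqrt.inv).mul (h4.const_mul _).exp

/-! ### Change of variables by a symmetric root of the covariance -/

theorem dotProduct_inv_mulVec {D : ℕ} {A : Matrix (Fin D) (Fin D) ℝ} (hA : Aᵀ = A)
    (hd : A.det ≠ 0) (x : Fin D → ℝ) : (A *ᵥ x) ⬝ᵥ ((A * A)⁻¹ *ᵥ (A *ᵥ x)) = ∑ i, x i ^ 2 := by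
  rw [Matrix.mulVec_mulVec, Matrix.mul_inv_rev, Matrix.mul_assoc,
    Matrix.nonsing_inv_mul _ (isUnit_iff_ne_zero.mpr hd), Matrix.mul_one,
    Matrix.dotProduct_mulVec, ← Matrix.mulVec_transpose, Matrix.transpose_nonsing_inv, hA,
    Matrix.mulVec_mulVec, Matrix.nonsing_inv_mul _ (isUnit_iff_ne_zero.mpr hd),
    Matrix.one_mulVec]
  simp [dotProduct, sq]

theorem gaussianDensity_affine {D : ℕ} (m : Pt D) {A : Matrix (Fin D) (Fin D) ℝ} (hA : Aᵀ = A)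
    (hd : A.det ≠ 0) (x : Pt D) :
    |A.det| * gaussianDensity m (A * A) (m + Matrix.toEuclideanLin A x) =
      (Real.sqrt ((2 * Real.pi) ^ D))⁻¹ * Real.exp (-(1 / 2) * ∑ i, x i ^ 2) := by
  have e : (fun i => (m + Matrix.toEuclideanLin A x) i - m i) = A *ᵥ (WithLp.ofLp x) := by
    ext i
    rw [PiLp.add_apply, add_sub_cancel_left]
    rfl
  rw [gaussianDensity, e, dotProduct_inv_mulVec hA hd, Matrix.det_mul,
    Real.sqrt_mul (by positivity), Real.sqrt_mul_self_eq_abs]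
  have := abs_ne_zero.mpr hd
  field_simp

theorem map_affine_volume {D : ℕ} (m : Pt D) {A : Matrix (Fin D) (Fin D) ℝ} (hd : A.det ≠ 0) :
    (volume : Measure (Pt D)).map (fun x => m + Matrix.toEuclideanLin A x) =
      ENNReal.ofReal |A.det|⁻¹ • volume := by
  have hdl : LinearMap.det (Matrix.toEuclideanLin A) = A.det :=
    LinearMap.det_toLin (PiLp.basisFun 2 ℝ (Fin D)) A
  have h := Measure.map_map (μ := (volume : Measure (Pt D))) (measurable_const_add m)
    (Matrix.toEuclideanLin A).continuous_of_finiteDimensional.measurable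
  rw [Measure.map_linearMap_addHaar_eq_smul_addHaar _ (by rwa [hdl]), hdl, Measure.map_smul,
    map_add_left_eq_self, abs_inv] at h
  exact h.symm

/-- Change of variables with constant Jacobian: `d` is the factor by which `g` rescales `ν`, and `c`
compensates it in the density. -/
theorem map_withDensity_of_map_eq_smul {α : Type*} [MeasurableSpace α] {ν : Measure α}
    {g : α → α} (hg : Measurable g) {f : α → ENNReal} (hf : Measurable f) {c d : ENNReal}
    (hν : ν.map g = d • ν) (hcd : c * d = 1) :
    (ν.withDensity (c • (f ∘ g))).map g = ν.withDensity f := by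
  rw [withDensity_smul _ (hf.comp hg), Measure.map_smul, map_withDensity_comp hg hf, hν,
    withDensity_smul_measure, smul_smul, hcd, one_smul]

theorem map_affine_stdGaussian {D : ℕ} (m : Pt D) {A : Matrix (Fin D) (Fin D) ℝ} (hA : Aᵀ = A)
    (hd : A.det ≠ 0) :
    (stdGaussian (Pt D)).map (fun x => m + Matrix.toEuclideanLin A x) =
      volume.withDensity fun z => ENNReal.ofReal (gaussianDensity m (A * A) z) := by
  have hgm : Measurable fun x => m + Matrix.toEuclideanLin A x :=
    measurable_const.add (Matrix.toEuclideanLin A).continuous_of_finiteDimensional.measurable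
  have hfm : Measurable fun z => ENNReal.ofReal (gaussianDensity m (A * A) z) :=
    (measurable_gaussianDensity (m := fun _ => m) (S := fun _ => A * A) (z := fun z => z)
      measurable_const (fun _ _ => measurable_const) measurable_id).ennreal_ofReal
  rw [stdGaussian_eq_withDensity, ← map_withDensity_of_map_eq_smul (c := ENNReal.ofReal |A.det|)
    hgm hfm (map_affine_volume m hd) (by
      rw [← ENNReal.ofReal_mul (abs_nonneg _), mul_inv_cancel₀ (abs_ne_zero.mpr hd),
        ENNReal.ofReal_one])]
  congr 2
  ext x
  rw [← gaussianDensity_affine m hA hd x, ENNReal.ofReal_mul (abs_nonneg _)]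
  rfl

open scoped MatrixOrder in
-- `multivariateGaussian m S` is the image of the standard Gaussian under `x ↦ m + √S x`. The root
-- `√S` is symmetric and invertible, so the affine change of variables applies with `A * A = S`.
theorem multivariateGaussian_eq_withDensity {D : ℕ} (m : Pt D) {S : Matrix (Fin D) (Fin D) ℝ}
    (hS : S.PosDef) : multivariateGaussian m S =
      volume.withDensity fun z => ENNReal.ofReal (gaussianDensity m S z) := by
  have hAA : CFC.sqrt S * CFC.sqrt S = S := CFC.sqrt_mul_sqrt_self S hS.posSemidef.nonneg
  have hAh : (CFC.sqrt S).IsHermitian :=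
    (Matrix.nonneg_iff_posSemidef.mp (CFC.sqrt_nonneg S)).isHermitian
  have hd : (CFC.sqrt S).det ≠ 0 := fun h =>
    hS.det_pos.ne' (by rw [← hAA, Matrix.det_mul, h, zero_mul])
  have h := map_affine_stdGaussian m (A := CFC.sqrt S) hAh hd
  rw [hAA] at h
  exact h

end Gaussian

/-! ### The laws in the algorithm are measurable families of probability measures -/

section Regularity

theorem MarkovFamily.foldl_bind {α σ τ : Type*} [MeasurableSpace α] [MeasurableSpace σ]
    {κ : τ → α → σ → Measure σ} (hκ : ∀ t, MarkovFamily (Function.uncurry (κ t))) (L : List τ)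
    {μ : α → Measure σ} (hμ : MarkovFamily μ) :
    MarkovFamily fun a => L.foldl (fun ν t => ν.bind (κ t a)) (μ a) := by
  induction L generalizing μ with
  | nil => exact hμ
  | cons t L ih => exact ih (hμ.bind (hκ t))

/-- The Markov property of a chain of steps. It allows the first step of a fold to be peeled off,
which the backward pass needs because its times are run in reverse. -/
theorem foldl_bind_eq_bind {σ τ : Type*} [MeasurableSpace σ] {κ : τ → σ → Measure σ}
    (hκ : ∀ t, MarkovFamily (κ t)) (L : List τ) (μ : Measure σ) :
    L.foldl (fun ν t => ν.bind (κ t)) μ =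
      μ.bind fun a => L.foldl (fun ν t => ν.bind (κ t)) (Measure.dirac a) := by
  induction L generalizing μ with
  | nil => exact Measure.bind_dirac.symm
  | cons t L ih =>
    simp only [List.foldl_cons]
    have hm : Measurable fun a => L.foldl (fun ν t => ν.bind (κ t)) (Measure.dirac a) :=
      (MarkovFamily.foldl_bind (α := σ) (κ := fun t _ => κ t)
        (fun t => (hκ t).comp measurable_snd) L (MarkovFamily.dirac measurable_id)).measurable
    rw [ih, Measure.bind_bind (hκ t).measurable.aemeasurable hm.aemeasurable]
    congr 1
    funext a
    rw [Measure.dirac_bind (hκ t).measurable, ih]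

/-! ### Lineages and their measurability -/

variable {T D N : ℕ}

/-- `x_{n-1}^i`, as a function of a natural number `n`. -/
def prevState (S : Particles T D N) : ℕ → Fin (N + 1) → Pt D
  | 0, _ => 0
  | n + 1, i => if h : n < T then (S ⟨n, h⟩ i).2 else 0

/-- `x_{n-2}^{(i)}` for a lineage that ends at time `n - 1`. -/
def prevParent (S : Particles T D N) : ℕ → Fin (N + 1) → Pt D
  | 0, _ => 0
  | n + 1, i => if h : n < T then parent S ⟨n, h⟩ i else 0

/-- Generation `t` enters only through the ancestor index; the rest depends on earlier generations.
This separation governs what an update of generation `t` changes. -/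
theorem parent_eq (S : Particles T D N) (t : Fin T) (n : Fin (N + 1)) :
    parent S t n = prevState S t (S t n).1 := by
  obtain ⟨_ | t, ht⟩ := t
  · simp [parent, prevState]
  · simp [parent, prevState, before, Nat.lt_of_succ_lt ht]

theorem grandparent_eq (S : Particles T D N) (t : Fin T) (n : Fin (N + 1)) :
    grandparent S t n = prevParent S t (S t n).1 := by
  obtain ⟨_ | t, ht⟩ := t
  · simp [grandparent, prevParent]
  · simp [grandparent, prevParent, before, Nat.lt_of_succ_lt ht]

section Measurability

variable {α : Type*} [MeasurableSpace α] {S : α → Particles T D N} {i : α → Fin (N + 1)}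

theorem measurable_particle (t : Fin T) (hS : Measurable S) (hi : Measurable i) :
    Measurable fun a => S a t (i a) :=
  measurable_eval_index (f := fun a => S a t) ((measurable_pi_apply t).comp hS) hi

theorem measurable_prevState (n : ℕ) (hS : Measurable S) (hi : Measurable i) :
    Measurable fun a => prevState (S a) n (i a) := by
  cases n with
  | zero => exact measurable_const
  | succ n =>
    simp only [prevState]
    split_ifs with h
    · exact (measurable_particle _ hS hi).snd
    · exact measurable_const

theorem measurable_parent (t : Fin T) (hS : Measurable S) (hi : Measurable i) :
    Measurable fun a => parent (S a) t (i a) := by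
  simp_rw [parent_eq]
  exact measurable_prevState t hS (measurable_particle t hS hi).fst

theorem measurable_prevParent (n : ℕ) (hS : Measurable S) (hi : Measurable i) :
    Measurable fun a => prevParent (S a) n (i a) := by
  cases n with
  | zero => exact measurable_const
  | succ n =>
    simp only [prevParent]
    split_ifs with h
    · exact measurable_parent _ hS hi
    · exact measurable_const

theorem measurable_grandparent (t : Fin T) (hS : Measurable S) (hi : Measurable i) :
    Measurable fun a => grandparent (S a) t (i a) := by
  simp_rw [grandparent_eq]
  exact measurable_prevParent t hS (measurable_particle t hS hi).fst

theorem measurable_path {l : α → Fin T → Fin (N + 1)} (hS : Measurable S) (hl : Measurable l) :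
    Measurable fun a t => (S a t (l a t)).2 :=
  measurable_pi_lambda _ fun t =>
    (measurable_particle t hS ((measurable_pi_apply t).comp hl)).snd

end Measurability

/-! ### Normalised weights -/

theorem normalise_nonneg {w : Fin (N + 1) → ℝ} (hw : ∀ n, 0 < w n) (n : Fin (N + 1)) :
    0 ≤ normalise w n :=
  div_nonneg (hw n).le (Finset.sum_nonneg fun m _ => (hw m).le)

theorem sum_pos_of_pos {w : Fin (N + 1) → ℝ} (hw : ∀ n, 0 < w n) : 0 < ∑ m, w m :=
  Finset.sum_pos (fun m _ => hw m) Finset.univ_nonempty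

theorem normalise_pos {w : Fin (N + 1) → ℝ} (hw : ∀ n, 0 < w n) (n : Fin (N + 1)) :
    0 < normalise w n :=
  div_pos (hw n) (sum_pos_of_pos hw)

theorem sum_normalise {w : Fin (N + 1) → ℝ} (hw : ∀ n, 0 < w n) : ∑ n, normalise w n = 1 := by
  simp_rw [normalise, ← Finset.sum_div]
  exact div_self (sum_pos_of_pos hw).ne'

theorem normalise_const_mul {c : ℝ} (hc : c ≠ 0) (w : Fin (N + 1) → ℝ) :
    normalise (fun n => c * w n) = normalise w := by
  ext n
  simp_rw [normalise, ← Finset.mul_sum]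
  exact mul_div_mul_left _ _ hc

theorem measurable_normalise {α : Type*} [MeasurableSpace α] {w : α → Fin (N + 1) → ℝ}
    (hw : Measurable w) : Measurable fun a => normalise (w a) :=
  measurable_pi_lambda _ fun n => ((measurable_pi_apply n).comp hw).div
    (Finset.measurable_sum _ fun m _ => (measurable_pi_apply m).comp hw)

/-! ### Regular models and the laws built from them -/

variable {U : Type*} [MeasurableSpace U]

/-- Mutation densities and potentials that depend measurably on a parameter, and for which all the
path densities are strictly positive. -/
structure Regular (M : U → Fin T → Pt D → Pt D → ℝ)
    (G : U → Fin T → Pt D → Pt D → Pt D → ℝ) : Prop where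
  M_meas : ∀ t, Measurable fun p : U × Pt D × Pt D => M p.1 t p.2.1 p.2.2
  M_nonneg : ∀ u t x₁ x₂, 0 ≤ M u t x₁ x₂
  M_prob : ∀ u t x₁, ∫⁻ z, ENNReal.ofReal (M u t x₁ z) = 1
  G_pos : ∀ u t x₀ x₁ x₂, 0 < G u t x₀ x₁ x₂
  G_meas : ∀ t, Measurable fun p : U × Pt D × Pt D × Pt D => G p.1 t p.2.1 p.2.2.1 p.2.2.2
  step_pos : ∀ u (x : Fin T → Pt D) t,
    0 < stepDensity (M u) (G u) t (lag2 x t) (lag1 x t) (x t)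

variable {M : U → Fin T → Pt D → Pt D → ℝ} {G : U → Fin T → Pt D → Pt D → Pt D → ℝ}

namespace Regular

variable {α : Type*} [MeasurableSpace α] {u : α → U} {S : α → Particles T D N}
  {k l : α → Fin T → Fin (N + 1)} {x : α → Fin T → Pt D}

theorem stepDensity_pos (h : Regular M G) (u : U) (t : Fin T) {x₀ x₁ : Pt D} (x₂ : Pt D)
    (h₀ : t.val < 2 → x₀ = 0) (h₁ : t.val < 1 → x₁ = 0) :
    0 < stepDensity (M u) (G u) t x₀ x₁ x₂ := by
  -- Positivity is known only for triples read off a path. With dummies where no earlier time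
  -- exists, every triple comes from a path: `x₂` at `t`, `x₁` just before, `x₀` elsewhere.
  have := h.step_pos u
    (fun s => if s.val = t.val then x₂ else if s.val + 1 = t.val then x₁ else x₀) t
  obtain ⟨_ | _ | t, ht⟩ := t
  · simpa [lag1, lag2, h₀, h₁] using this
  · simpa [lag1, lag2, before, h₀, h₁] using this
  · simpa [lag1, lag2, before, show t ≠ t + 1 + 1 by omega] using this

theorem measurable_stepDensity (h : Regular M G) (t : Fin T) (hu : Measurable u)
    {x₀ x₁ x₂ : α → Pt D} (h₀ : Measurable x₀) (h₁ : Measurable x₁) (h₂ : Measurable x₂) :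
    Measurable fun a => stepDensity (M (u a)) (G (u a)) t (x₀ a) (x₁ a) (x₂ a) :=
  ((h.M_meas t).comp (hu.prodMk (h₁.prodMk h₂))).mul
    ((h.G_meas t).comp (hu.prodMk (h₀.prodMk (h₁.prodMk h₂))))

theorem weight_pos (h : Regular M G) (u : U) (S : Particles T D N) (t : Fin T)
    (n : Fin (N + 1)) : 0 < weight (G u) S t n :=
  normalise_pos (fun _ => h.G_pos u t _ _ _) n

theorem sum_weight (h : Regular M G) (u : U) (S : Particles T D N) (t : Fin T) :
    ∑ n, weight (G u) S t n = 1 :=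
  sum_normalise fun _ => h.G_pos u t _ _ _

theorem measurable_weight (h : Regular M G) (t : Fin T) (hu : Measurable u) (hS : Measurable S) :
    Measurable fun a => weight (G (u a)) (S a) t :=
  measurable_normalise (measurable_pi_lambda _ fun _ => (h.G_meas t).comp
    (hu.prodMk ((measurable_grandparent t hS measurable_const).prodMk
      ((measurable_parent t hS measurable_const).prodMk
        (measurable_particle t hS measurable_const).snd))))

theorem mutationLaw (h : Regular M G) (t : Fin T) (hu : Measurable u) {x₁ : α → Pt D}
    (h₁ : Measurable x₁) : MarkovFamily fun a => mutationLaw (M (u a)) t (x₁ a) := by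
  have hm : Measurable fun q : α × Pt D => ENNReal.ofReal (M (u q.1) t (x₁ q.1) q.2) :=
    ((h.M_meas t).comp ((hu.comp measurable_fst).prodMk
      ((h₁.comp measurable_fst).prodMk measurable_snd))).ennreal_ofReal
  refine ⟨Measure.measurable_of_measurable_coe _ fun s hs => ?_, fun p => ⟨?_⟩⟩
  · simp_rw [AuxCSMC.mutationLaw, withDensity_apply _ hs]
    exact hm.lintegral_prod_right'
  · rw [AuxCSMC.mutationLaw, withDensity_apply _ .univ, setLIntegral_univ, h.M_prob]

theorem proposalLaw (h : Regular M G) (t : Fin T) (hu : Measurable u) (hS : Measurable S) :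
    MarkovFamily fun a => proposalLaw (M (u a)) (G (u a)) (S a) t := by
  simp only [AuxCSMC.proposalLaw]
  split_ifs with ht
  · refine MarkovFamily.bind (MarkovFamily.categorical (h.measurable_weight _ hu hS)
      (fun a i => (h.weight_pos _ _ _ i).le) fun a => h.sum_weight _ _ _) ?_
    have h1 : MarkovFamily fun q : α × Fin (N + 1) =>
        AuxCSMC.mutationLaw (M (u q.1)) t (S q.1 (before t) q.2).2 :=
      h.mutationLaw t (hu.comp measurable_fst)
        (measurable_particle (before t) (hS.comp measurable_fst) measurable_snd).snd
    exact h1.map (f := fun q z => (q.2, z)) (measurable_fst.snd.prodMk measurable_snd)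
  · exact (h.mutationLaw t hu measurable_const).map (measurable_const.prodMk measurable_snd)

theorem uniform : MarkovFamily fun _ : α => categorical fun _ : Fin (N + 1) => 1 / ((N : ℝ) + 1) :=
  MarkovFamily.categorical measurable_const (fun _ _ => by positivity) fun _ => by
    simp
    field_simp

theorem forwardStep (h : Regular M G) (t : Fin T) (hu : Measurable u) (hx : Measurable x)
    {s : α → (Fin T → Fin (N + 1)) × Particles T D N} (hs : Measurable s) :
    MarkovFamily fun a => forwardStep (M (u a)) (G (u a)) (x a) t (s a) := by
  have hr : Measurable fun q : α × Fin (N + 1) =>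
      ((if 1 ≤ t.val then (s q.1).1 (before t) else 0 : Fin (N + 1)), x q.1 t) := by
    refine Measurable.prodMk ?_ ((measurable_pi_apply t).comp (hx.comp measurable_fst))
    split_ifs
    · exact (measurable_pi_apply (before t)).comp (hs.comp measurable_fst).fst
    · exact measurable_const
  have hp : MarkovFamily fun q : α × Fin (N + 1) =>
      AuxCSMC.proposalLaw (M (u q.1)) (G (u q.1)) (s q.1).2 t :=
    h.proposalLaw t (hu.comp measurable_fst) (hs.comp measurable_fst).snd
  have hs' : Measurable fun q : (α × Fin (N + 1)) × (Fin (N + 1) → Fin (N + 1) × Pt D) =>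
      s q.1.1 := hs.comp measurable_fst.fst
  have hu1 : Measurable fun q : (α × Fin (N + 1)) × (Fin (N + 1) → Fin (N + 1) × Pt D) =>
      Function.update (s q.1.1).1 t q.1.2 :=
    measurable_update'.comp (hs'.fst.prodMk measurable_fst.snd)
  have hu2 : Measurable fun q : (α × Fin (N + 1)) × (Fin (N + 1) → Fin (N + 1) × Pt D) =>
      Function.update (s q.1.1).2 t q.2 :=
    measurable_update'.comp (hs'.snd.prodMk measurable_snd)
  exact uniform.bind ((hp.pi_replace hr measurable_snd).map (hu1.prodMk hu2))

theorem forwardFold (h : Regular M G) (L : List (Fin T)) (hu : Measurable u) (hx : Measurable x) :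
    MarkovFamily fun a =>
      L.foldl (fun μ t => μ.bind (AuxCSMC.forwardStep (N := N) (M (u a)) (G (u a)) (x a) t))
        (Measure.dirac (0, 0)) :=
  MarkovFamily.foldl_bind (κ := fun t a => AuxCSMC.forwardStep (M (u a)) (G (u a)) (x a) t)
    (fun t => h.forwardStep t (hu.comp measurable_fst) (hx.comp measurable_fst) measurable_snd) L
    (MarkovFamily.dirac measurable_const)

theorem backwardWeight_pos (h : Regular M G) (u : U) (S : Particles T D N)
    (l : Fin T → Fin (N + 1)) (t : Fin T) (h1 : t.val + 1 < T) (i : Fin (N + 1)) :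
    0 < backwardWeight (M u) (G u) S l t h1 i := by
  have e1 := h.weight_pos u S t i
  have e2 : 0 < stepDensity (M u) (G u) ⟨t.val + 1, h1⟩ (parent S t i) (S t i).2
      (S ⟨t.val + 1, h1⟩ (l ⟨t.val + 1, h1⟩)).2 :=
    h.stepDensity_pos u _ _ (fun ht => by
      have : t.val = 0 := by simp at ht; omega
      simp [parent, this]) (by simp)
  unfold backwardWeight
  split_ifs with h2
  · have e3 := h.stepDensity_pos u ⟨t.val + 2, h2⟩ (x₀ := (S t i).2)
      (x₁ := (S ⟨t.val + 1, h1⟩ (l ⟨t.val + 1, h1⟩)).2)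
      (S ⟨t.val + 2, h2⟩ (l ⟨t.val + 2, h2⟩)).2 (by simp) (by simp)
    positivity
  · positivity

theorem measurable_backwardWeight (h : Regular M G) (t : Fin T) (h1 : t.val + 1 < T)
    (hu : Measurable u) (hS : Measurable S) (hl : Measurable l) :
    Measurable fun a => backwardWeight (M (u a)) (G (u a)) (S a) (l a) t h1 := by
  refine measurable_pi_lambda _ fun i => ?_
  have hy : ∀ s, Measurable fun a => (S a s (l a s)).2 := fun s =>
    (measurable_particle s hS ((measurable_pi_apply s).comp hl)).snd
  have hx : Measurable fun a => (S a t i).2 := (measurable_particle t hS measurable_const).snd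
  refine Measurable.mul (Measurable.mul ?_ ?_) ?_
  · exact (measurable_pi_apply i).comp (h.measurable_weight t hu hS)
  · exact h.measurable_stepDensity _ hu (measurable_parent t hS measurable_const) hx (hy _)
  · split_ifs with h2
    · exact h.measurable_stepDensity _ hu hx (hy _) (hy _)
    · exact measurable_const

end Regular

/-- The proposal probabilities of the forced move sum to one. -/
theorem sum_forcedMove_proposal (hN : 1 ≤ N) {W : Fin (N + 1) → ℝ} (hW : ∀ i, 0 < W i)
    (h1 : ∑ i, W i = 1) (k : Fin (N + 1)) :
    W k < 1 ∧ ∑ i, (if i = k then 0 else W i / (1 - W k)) = 1 := by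
  have hs : W k + ∑ i ∈ Finset.univ.erase k, W i = 1 := by
    rw [Finset.add_sum_erase _ _ (Finset.mem_univ k), h1]
  -- Here `1 ≤ N` matters: with another index of positive weight, `W k < 1` and the proposal is well
  -- defined.
  have hne : (Finset.univ.erase k).Nonempty := by
    rw [← Finset.card_pos, Finset.card_erase_of_mem (Finset.mem_univ k)]
    simp
    omega
  have hpos : 0 < ∑ i ∈ Finset.univ.erase k, W i := Finset.sum_pos (fun i _ => hW i) hne
  refine ⟨by linarith, ?_⟩
  rw [← Finset.add_sum_erase _ _ (Finset.mem_univ k), if_pos rfl, zero_add,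
    Finset.sum_congr rfl fun i hi => if_neg (Finset.ne_of_mem_erase hi), ← Finset.sum_div]
  rw [div_eq_one_iff_eq (by linarith)]
  linarith

theorem lintegral_forcedMove (W : Fin (N + 1) → ℝ) (k : Fin (N + 1))
    (f : Fin (N + 1) → ENNReal) :
    ∫⁻ l, f l ∂forcedMove W k = ∑ i, ENNReal.ofReal (if i = k then 0 else W i / (1 - W k)) *
      (ENNReal.ofReal (min 1 ((1 - W k) / (1 - W i))) * f i +
        ENNReal.ofReal (1 - min 1 ((1 - W k) / (1 - W i))) * f k) := by
  rw [forcedMove, Measure.lintegral_bind (measurable_of_countable _).aemeasurable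
    (measurable_of_countable _).aemeasurable, lintegral_categorical]
  simp [lintegral_add_measure]

theorem MarkovFamily.forcedMove (hN : 1 ≤ N) {α : Type*} [MeasurableSpace α]
    {W : α → Fin (N + 1) → ℝ} {k : α → Fin (N + 1)} (hm : Measurable W) (hk : Measurable k)
    (hW : ∀ a i, 0 < W a i) (h1 : ∀ a, ∑ i, W a i = 1) :
    MarkovFamily fun a => forcedMove (W a) (k a) := by
  have hi : ∀ i, Measurable fun a => W a i := fun i => (measurable_pi_apply i).comp hm
  have hWk : Measurable fun a => W a (k a) := measurable_eval_index hm hk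
  have hmin : ∀ i, Measurable fun a => min 1 ((1 - W a (k a)) / (1 - W a i)) := fun i =>
    measurable_const.min ((measurable_const.sub hWk).div (measurable_const.sub (hi i)))
  refine ⟨Measure.measurable_of_measurable_coe _ fun s hs => ?_, fun a => ⟨?_⟩⟩
  · simp_rw [← lintegral_indicator_one hs, lintegral_forcedMove]
    refine Finset.measurable_sum _ fun i _ => ?_
    refine (Measurable.ennreal_ofReal (Measurable.ite
      (measurableSet_eq_fun measurable_const hk) measurable_const
      ((hi i).div (measurable_const.sub hWk)))).mul
      (((hmin i).ennreal_ofReal.mul_const _).add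
        ((measurable_const.sub (hmin i)).ennreal_ofReal.mul
          ((measurable_of_countable (s.indicator 1)).comp hk)))
  · have hp := fun i => (sum_forcedMove_proposal hN (hW a) (h1 a) i).1
    have hmin0 : ∀ i, 0 ≤ min 1 ((1 - W a (k a)) / (1 - W a i)) := fun i =>
      le_min zero_le_one (div_nonneg (by linarith [hp (k a)]) (by linarith [hp i]))
    rw [← lintegral_one, lintegral_forcedMove]
    simp_rw [mul_one, ← ENNReal.ofReal_add (hmin0 _) (sub_nonneg.mpr (min_le_left _ _)),
      add_sub_cancel, ENNReal.ofReal_one, mul_one]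
    rw [← ENNReal.ofReal_sum_of_nonneg, (sum_forcedMove_proposal hN (hW a) (h1 a) (k a)).2,
      ENNReal.ofReal_one]
    intro i _
    split_ifs
    · exact le_rfl
    · exact div_nonneg (hW a i).le (by linarith [hp (k a)])

namespace Regular

variable {α : Type*} [MeasurableSpace α] {u : α → U} {S : α → Particles T D N}
  {k l : α → Fin T → Fin (N + 1)} {x : α → Fin T → Pt D}

theorem indexLaw (h : Regular M G) (hN : 1 ≤ N) (t : Fin T) (hu : Measurable u)
    (hk : Measurable k) (hS : Measurable S) (hl : Measurable l) :
    MarkovFamily fun a => indexLaw (M (u a)) (G (u a)) (k a) (S a) t (l a) := by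
  simp only [AuxCSMC.indexLaw]
  split_ifs with h1
  · exact MarkovFamily.categorical (measurable_normalise (h.measurable_backwardWeight t h1 hu hS hl))
      (fun a => normalise_nonneg (h.backwardWeight_pos _ _ _ _ _))
      fun a => sum_normalise (h.backwardWeight_pos _ _ _ _ _)
  · exact MarkovFamily.forcedMove hN (h.measurable_weight t hu hS)
      ((measurable_pi_apply t).comp hk) (fun a => h.weight_pos _ _ _) fun a => h.sum_weight _ _ _

theorem backwardStep (h : Regular M G) (hN : 1 ≤ N) (t : Fin T) (hu : Measurable u)
    (hk : Measurable k) (hS : Measurable S) (hl : Measurable l) :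
    MarkovFamily fun a => (AuxCSMC.indexLaw (M (u a)) (G (u a)) (k a) (S a) t (l a)).map
      fun i => Function.update (l a) t i :=
  (h.indexLaw hN t hu hk hS hl).map
    (measurable_update'.comp ((hl.comp measurable_fst).prodMk measurable_snd))

theorem backwardFold (h : Regular M G) (hN : 1 ≤ N) (L : List (Fin T)) (hu : Measurable u)
    (hk : Measurable k) (hS : Measurable S) (hl : Measurable l) :
    MarkovFamily fun a => L.foldl (fun μ t => μ.bind fun l =>
      (AuxCSMC.indexLaw (M (u a)) (G (u a)) (k a) (S a) t l).map fun i => Function.update l t i)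
      (Measure.dirac (l a)) :=
  MarkovFamily.foldl_bind (κ := fun t a l =>
    (AuxCSMC.indexLaw (M (u a)) (G (u a)) (k a) (S a) t l).map fun i => Function.update l t i)
    (fun t => h.backwardStep hN t (hu.comp measurable_fst) (hk.comp measurable_fst)
      (hS.comp measurable_fst) measurable_snd) _ (MarkovFamily.dirac hl)

theorem backwardLaw (h : Regular M G) (hN : 1 ≤ N) (hu : Measurable u)
    {s : α → (Fin T → Fin (N + 1)) × Particles T D N} (hs : Measurable s) :
    MarkovFamily fun a => backwardLaw (M (u a)) (G (u a)) (s a) :=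
  h.backwardFold hN _ hu hs.fst hs.snd measurable_const

theorem pathLaw (h : Regular M G) (hN : 1 ≤ N) (hu : Measurable u)
    {s : α → (Fin T → Fin (N + 1)) × Particles T D N} (hs : Measurable s) :
    MarkovFamily fun a =>
      (AuxCSMC.backwardLaw (M (u a)) (G (u a)) (s a)).map fun l t => ((s a).2 t (l t)).2 :=
  (h.backwardLaw hN hu hs).map (measurable_path (hs.comp measurable_fst).snd measurable_snd)

theorem csmcLaw (h : Regular M G) (hN : 1 ≤ N) (hu : Measurable u) (hx : Measurable x) :
    MarkovFamily fun a => csmcLaw N (M (u a)) (G (u a)) (x a) :=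
  (h.forwardFold _ hu hx).bind (h.pathLaw hN (hu.comp measurable_fst) measurable_snd)

end Regular

end Regularity

/-! ### The forward pass -/

section Forward

variable {T D N : ℕ}

/-- The value before step `n`, with the dummy value `0` if there is none. -/
def prev {β : Type*} [Zero β] (f : Fin T → β) : ℕ → β
  | 0 => 0
  | n + 1 => if h : n < T then f ⟨n, h⟩ else 0

theorem measurable_prev {α β : Type*} [Zero β] [MeasurableSpace α] [MeasurableSpace β] (n : ℕ)
    {f : α → Fin T → β} (hf : Measurable f) : Measurable fun a => prev (f a) n := by
  cases n with
  | zero => exact measurable_const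
  | succ n =>
    simp only [prev]
    split_ifs with h
    · exact (measurable_pi_apply _).comp hf
    · exact measurable_const

theorem prev_update {β : Type*} [Zero β] (f : Fin T → β) {t : Fin T} {n : ℕ} (hn : n ≤ t)
    (b : β) : prev (Function.update f t b) n = prev f n := by
  cases n with
  | zero => rfl
  | succ n =>
    simp only [prev]
    split_ifs with h
    · rw [Function.update_of_ne]
      exact Fin.ne_of_val_ne (by simp; omega)
    · rfl

theorem lag1_eq (x : Fin T → Pt D) (t : Fin T) : lag1 x t = prev x t := by
  obtain ⟨_ | t, ht⟩ := t
  · simp [lag1, prev]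
  · simp [lag1, prev, before, Nat.lt_of_succ_lt ht]

theorem lag2_eq (x : Fin T → Pt D) (t : Fin T) : lag2 x t = prev (lag1 x) t := by
  obtain ⟨_ | _ | t, ht⟩ := t
  · simp [lag2, prev]
  · simp [lag2, lag1, prev]
  · simp [lag2, lag1, prev, before, Nat.lt_of_succ_lt ht]

theorem measurable_lag1 (t : Fin T) : Measurable fun x : Fin T → Pt D => lag1 x t := by
  simp_rw [lag1_eq]
  exact measurable_prev t measurable_id

theorem measurable_lag2 (t : Fin T) : Measurable fun x : Fin T → Pt D => lag2 x t := by
  simp only [lag2]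
  split_ifs
  · exact measurable_pi_apply _
  · exact measurable_const

theorem lag1_update (x : Fin T → Pt D) {s t : Fin T} (hs : s ≤ t) (z : Pt D) :
    lag1 (Function.update x t z) s = lag1 x s := by
  rw [lag1_eq, lag1_eq, prev_update x hs]

theorem lag2_update (x : Fin T → Pt D) {s t : Fin T} (hs : s ≤ t) (z : Pt D) :
    lag2 (Function.update x t z) s = lag2 x s := by
  unfold lag2
  split_ifs with h
  · rw [Function.update_of_ne]
    exact Fin.ne_of_val_ne (by simp [before]; have : s.val ≤ t.val := hs; omega)
  · rfl

theorem prevState_update (S : Particles T D N) {t : Fin T} {n : ℕ} (hn : n ≤ t)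
    (g : Fin (N + 1) → Fin (N + 1) × Pt D) (i : Fin (N + 1)) :
    prevState (Function.update S t g) n i = prevState S n i := by
  cases n with
  | zero => rfl
  | succ n =>
    simp only [prevState]
    split_ifs with h
    · rw [Function.update_of_ne]
      exact Fin.ne_of_val_ne (by simp; omega)
    · rfl

theorem parent_update_of_lt (S : Particles T D N) {s t : Fin T} (hs : s < t)
    (g : Fin (N + 1) → Fin (N + 1) × Pt D) (i : Fin (N + 1)) :
    parent (Function.update S t g) s i = parent S s i := by
  rw [parent_eq, parent_eq, Function.update_of_ne hs.ne, prevState_update S (le_of_lt hs)]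

theorem parent_update_self (S : Particles T D N) (t : Fin T)
    (g : Fin (N + 1) → Fin (N + 1) × Pt D) (i : Fin (N + 1)) :
    parent (Function.update S t g) t i = prevState S t (g i).1 := by
  rw [parent_eq, Function.update_self, prevState_update S le_rfl]

theorem prevParent_update (S : Particles T D N) {t : Fin T} {n : ℕ} (hn : n ≤ t)
    (g : Fin (N + 1) → Fin (N + 1) × Pt D) (i : Fin (N + 1)) :
    prevParent (Function.update S t g) n i = prevParent S n i := by
  cases n with
  | zero => rfl
  | succ n =>
    simp only [prevParent]
    split_ifs with h
    · exact parent_update_of_lt S (show n < t.val from hn) g i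
    · rfl

theorem grandparent_update_of_lt (S : Particles T D N) {s t : Fin T} (hs : s < t)
    (g : Fin (N + 1) → Fin (N + 1) × Pt D) (i : Fin (N + 1)) :
    grandparent (Function.update S t g) s i = grandparent S s i := by
  rw [grandparent_eq, grandparent_eq, Function.update_of_ne hs.ne,
    prevParent_update S (le_of_lt hs)]

theorem grandparent_update_self (S : Particles T D N) (t : Fin T)
    (g : Fin (N + 1) → Fin (N + 1) × Pt D) (i : Fin (N + 1)) :
    grandparent (Function.update S t g) t i = prevParent S t (g i).1 := by
  rw [grandparent_eq, Function.update_self, prevParent_update S le_rfl]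

variable {M : Fin T → Pt D → Pt D → ℝ} {G : Fin T → Pt D → Pt D → Pt D → ℝ}

theorem weight_update_of_lt (S : Particles T D N) {s t : Fin T} (hs : s < t)
    (g : Fin (N + 1) → Fin (N + 1) × Pt D) :
    weight G (Function.update S t g) s = weight G S s := by
  ext i
  simp only [weight, parent_update_of_lt S hs, grandparent_update_of_lt S hs,
    Function.update_of_ne hs.ne]

/-! ### The unconditional particle system -/

variable (G) in
/-- The probabilities with which the ancestors of the particles at time `n` are drawn. -/
def ancestorWeight (S : Particles T D N) : ℕ → Fin (N + 1) → ℝ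
  | 0, i => if i = 0 then 1 else 0
  | n + 1, i => if h : n < T then weight G S ⟨n, h⟩ i else 0

theorem ancestorWeight_succ (S : Particles T D N) (t : Fin T) :
    ancestorWeight G S (t + 1) = weight G S t := by
  ext i
  simp [ancestorWeight]

theorem prevState_succ (S : Particles T D N) (t : Fin T) (i : Fin (N + 1)) :
    prevState S (t + 1) i = (S t i).2 := by
  simp [prevState]

theorem prevParent_succ (S : Particles T D N) (t : Fin T) (i : Fin (N + 1)) :
    prevParent S (t + 1) i = parent S t i := by
  simp [prevParent]

theorem prev_succ {β : Type*} [Zero β] (f : Fin T → β) (t : Fin T) : prev f (t + 1) = f t := by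
  simp [prev]

theorem lintegral_mutationLaw (h : Regular (fun _ : Unit => M) fun _ => G) (t : Fin T)
    (x₁ : Pt D) {f : Pt D → ENNReal} (hf : Measurable f) :
    ∫⁻ z, f z ∂mutationLaw M t x₁ = ∫⁻ z, ENNReal.ofReal (M t x₁ z) * f z := by
  have hm : Measurable fun z => ENNReal.ofReal (M t x₁ z) :=
    ((h.M_meas t).comp (measurable_const.prodMk
      (measurable_const.prodMk measurable_id) : Measurable fun z => ((), x₁, z))).ennreal_ofReal
  rw [mutationLaw, lintegral_withDensity_eq_lintegral_mul _ hm hf]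
  rfl

/-- The first time fits the general formula because there `ancestorWeight` is the point mass at the
dummy ancestor `0` and `prevState` is the dummy state. -/
theorem lintegral_proposalLaw (h : Regular (fun _ : Unit => M) fun _ => G)
    (S : Particles T D N) (t : Fin T) {f : Fin (N + 1) × Pt D → ENNReal} (hf : Measurable f) :
    ∫⁻ p, f p ∂proposalLaw M G S t = ∑ i, ENNReal.ofReal (ancestorWeight G S t i) *
      ∫⁻ z, ENNReal.ofReal (M t (prevState S t i) z) * f (i, z) := by
  have hi : ∀ i, Measurable fun z => f (i, z) := fun i => hf.comp measurable_prodMk_left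
  obtain ⟨_ | t, ht⟩ := t
  · simp only [proposalLaw, ancestorWeight, prevState]
    rw [if_neg (by simp), lintegral_map hf measurable_prodMk_left, lintegral_mutationLaw h _ _ (hi 0),
      Finset.sum_eq_single 0 (fun i _ hi => by simp [hi]) (by simp)]
    simp
  · simp only [proposalLaw, ancestorWeight, prevState, before]
    rw [if_pos (by simp), Measure.lintegral_bind (measurable_of_countable _).aemeasurable
      hf.aemeasurable, lintegral_categorical]
    refine Finset.sum_congr rfl fun i _ => ?_
    rw [lintegral_map hf measurable_prodMk_left, lintegral_mutationLaw h _ _ (hi i)]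
    simp [Nat.lt_of_succ_lt ht]

theorem lintegral_forwardStep (x : Fin T → Pt D)
    (t : Fin T) (s : (Fin T → Fin (N + 1)) × Particles T D N)
    {f : (Fin T → Fin (N + 1)) × Particles T D N → ENNReal} (hf : Measurable f) :
    ∫⁻ s', f s' ∂forwardStep M G x t s = ∑ j : Fin (N + 1), ENNReal.ofReal (1 / ((N : ℝ) + 1)) *
      ∫⁻ g, f (Function.update s.1 t j, Function.update s.2 t g)
        ∂Measure.pi fun n : Fin (N + 1) => if n = j then
          Measure.dirac (prev s.1 t, x t) else proposalLaw M G s.2 t := by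
  have e : (if 1 ≤ t.val then s.1 (before t) else 0) = prev s.1 t := by
    obtain ⟨_ | t, ht⟩ := t
    · simp [prev]
    · simp [prev, before, Nat.lt_of_succ_lt ht]
  rw [forwardStep, Measure.lintegral_bind (measurable_of_countable _).aemeasurable
      hf.aemeasurable, lintegral_categorical, e]
  refine Finset.sum_congr rfl fun j _ => ?_
  rw [lintegral_map hf]
  exact measurable_const.prodMk (measurable_update s.2)

variable (M G) in
/-- The expectation, over the particles at time `t`, of the mean weight times `f`. -/
def particleStep (t : Fin T) (f : Particles T D N → ENNReal) (S : Particles T D N) : ENNReal :=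
  ∫⁻ g, ENNReal.ofReal (∑ m, G t (grandparent (Function.update S t g) t m)
      (parent (Function.update S t g) t m) (Function.update S t g t m).2) *
    (ENNReal.ofReal (1 / ((N : ℝ) + 1)) * f (Function.update S t g))
    ∂Measure.pi fun _ : Fin (N + 1) => proposalLaw M G S t

variable (M G) in
/-- The expectation, under the unconditional particle system run up to time `n`, of the product of
the mean weights times `f`. -/
def particleExpectation : ℕ → (Particles T D N → ENNReal) → ENNReal
  | 0, f => f 0
  | n + 1, f => particleExpectation n fun S =>
      if h : n < T then particleStep M G ⟨n, h⟩ f S else f S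

theorem particleExpectation_succ (t : Fin T) (f : Particles T D N → ENNReal) :
    particleExpectation M G (t + 1) f = particleExpectation M G t (particleStep M G t f) := by
  simp [particleExpectation]

/-- Many-to-one formula for one step of the particle system. -/
theorem particleStep_sum_weight (h : Regular (fun _ : Unit => M) fun _ => G) (t : Fin T)
    (S : Particles T D N) {f : Fin (N + 1) → Fin (N + 1) × Pt D →
      (Fin (N + 1) → Fin (N + 1) × Pt D) → ENNReal}
    (hf : ∀ j, Measurable (Function.uncurry (f j)))
    {F : Particles T D N → ENNReal}
    (hF : ∀ g, F (Function.update S t g) = ∑ j, ENNReal.ofReal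
      (weight G (Function.update S t g) t j) * f j (g j) g) :
    particleStep M G t F S = ∑ i, ENNReal.ofReal (ancestorWeight G S t i) *
      ∫⁻ z, ENNReal.ofReal (stepDensity M G t (prevParent S t i) (prevState S t i) z) *
        ∑ j, ENNReal.ofReal (1 / ((N : ℝ) + 1)) * ∫⁻ g, f j (i, z) g
          ∂Measure.pi fun n : Fin (N + 1) => if n = j then
            Measure.dirac (i, z) else proposalLaw M G S t := by
  have hprop : MarkovFamily fun _ : Fin (N + 1) × Pt D => proposalLaw M G S t :=
    h.proposalLaw t (u := fun _ => ()) measurable_const measurable_const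
  have : IsProbabilityMeasure (proposalLaw M G S t) := hprop.isProb (0, 0)
  have hG : Measurable fun p : Fin (N + 1) × Pt D =>
      ENNReal.ofReal (G t (prevParent S t p.1) (prevState S t p.1) p.2) :=
    ((h.G_meas t).comp ((measurable_const.prodMk ((measurable_prevParent t measurable_const
      measurable_fst).prodMk ((measurable_prevState t measurable_const measurable_fst).prodMk
        measurable_snd))) : Measurable fun p : Fin (N + 1) × Pt D =>
        ((), prevParent S t p.1, prevState S t p.1, p.2))).ennreal_ofReal
  have hI : ∀ j, Measurable fun p : Fin (N + 1) × Pt D => ∫⁻ g, f j p g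
      ∂Measure.pi fun n : Fin (N + 1) => if n = j then
        Measure.dirac p else proposalLaw M G S t := fun j =>
    (hprop.pi_replace measurable_id measurable_const).measurable_lintegral (hf j)
  -- The sum of the weights cancels the denominator of `W^j`, leaving the unnormalised potential of
  -- particle `j`.
  have hcalc : ∀ g : Fin (N + 1) → Fin (N + 1) × Pt D,
      ENNReal.ofReal (∑ m, G t (grandparent (Function.update S t g) t m)
        (parent (Function.update S t g) t m) (Function.update S t g t m).2) *
      (ENNReal.ofReal (1 / ((N : ℝ) + 1)) * F (Function.update S t g)) =
      ∑ j, ENNReal.ofReal (1 / ((N : ℝ) + 1)) *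
        (ENNReal.ofReal (G t (prevParent S t (g j).1) (prevState S t (g j).1) (g j).2) *
          f j (g j) g) := by
    intro g
    have hw := sum_pos_of_pos (w := fun m => G t (grandparent (Function.update S t g) t m)
        (parent (Function.update S t g) t m) (Function.update S t g t m).2)
        fun _ => h.G_pos () t _ _ _
    rw [hF, Finset.mul_sum, Finset.mul_sum]
    refine Finset.sum_congr rfl fun j _ => ?_
    rw [mul_left_comm, ← mul_assoc (ENNReal.ofReal (∑ m, _)), ← ENNReal.ofReal_mul hw.le,
      weight, normalise, mul_div_cancel₀ _ hw.ne', grandparent_update_self, parent_update_self,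
      Function.update_self]
  have hterm : ∀ j, Measurable fun g : Fin (N + 1) → Fin (N + 1) × Pt D =>
      ENNReal.ofReal (G t (prevParent S t (g j).1) (prevState S t (g j).1) (g j).2) *
        f j (g j) g := fun j =>
    (hG.comp (measurable_pi_apply j)).mul
      (show Measurable fun g => Function.uncurry (f j) (g j, g) from
        (hf j).comp ((measurable_pi_apply j).prodMk measurable_id))
  simp only [particleStep, hcalc]
  rw [lintegral_finsetSum _ fun j _ => (hterm j).const_mul _]
  -- Particle `j` is singled out: it is drawn first from the proposal, then the generation is drawn
  -- with that particle held fixed.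
  have hj : ∀ j, ∫⁻ g, ENNReal.ofReal (1 / ((N : ℝ) + 1)) *
        (ENNReal.ofReal (G t (prevParent S t (g j).1) (prevState S t (g j).1) (g j).2) *
          f j (g j) g) ∂(Measure.pi fun _ : Fin (N + 1) => proposalLaw M G S t) =
      ∫⁻ p, ENNReal.ofReal (G t (prevParent S t p.1) (prevState S t p.1) p.2) *
        (ENNReal.ofReal (1 / ((N : ℝ) + 1)) * ∫⁻ g, f j p g
          ∂Measure.pi fun n : Fin (N + 1) => if n = j then
            Measure.dirac p else proposalLaw M G S t) ∂proposalLaw M G S t := by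
    intro j
    rw [lintegral_const_mul _ (hterm j), ← lintegral_pi_replace (proposalLaw M G S t) j
      (h := fun p g => ENNReal.ofReal (G t (prevParent S t p.1) (prevState S t p.1) p.2) *
        f j p g) ((hG.comp measurable_fst).mul (hf j)),
      ← lintegral_const_mul' _ _ ENNReal.ofReal_ne_top]
    refine lintegral_congr fun p => ?_
    rw [lintegral_const_mul' _ _ ENNReal.ofReal_ne_top, mul_left_comm]
  simp_rw [hj]
  have hGI : ∀ j, Measurable fun p : Fin (N + 1) × Pt D =>
      ENNReal.ofReal (G t (prevParent S t p.1) (prevState S t p.1) p.2) *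
        (ENNReal.ofReal (1 / ((N : ℝ) + 1)) * ∫⁻ g, f j p g
          ∂Measure.pi fun n : Fin (N + 1) => if n = j then
            Measure.dirac p else proposalLaw M G S t) := fun j => hG.mul ((hI j).const_mul _)
  have hsum := Finset.measurable_sum Finset.univ fun j _ => hGI j
  -- The singled-out particle splits into an ancestor `i` and a state `z` with density `M`, which
  -- combines with `G` to give `stepDensity`.
  rw [← lintegral_finsetSum _ fun j _ => hGI j, lintegral_proposalLaw h _ _ hsum]
  refine Finset.sum_congr rfl fun i _ => ?_
  congr 1
  refine lintegral_congr fun z => ?_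
  rw [stepDensity, ENNReal.ofReal_mul (h.M_nonneg () t _ _), mul_assoc, ← Finset.mul_sum]

end Forward

/-! ### The conditional forward pass as a weighted unconditional system -/

section ForwardIdentity

variable {T D N : ℕ} {M : Fin T → Pt D → Pt D → ℝ} {G : Fin T → Pt D → Pt D → Pt D → ℝ}

theorem take_finRange_succ (t : Fin T) :
    (List.finRange T).take (t + 1) = (List.finRange T).take t ++ [t] := by
  rw [List.take_succ_eq_append_getElem (by simp)]
  simp

variable (N M G) in
/-- The law of the reference indices and the particle system before step `n` of the forward pass. -/
def forwardPrefix (x : Fin T → Pt D) (n : ℕ) :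
    Measure ((Fin T → Fin (N + 1)) × Particles T D N) :=
  ((List.finRange T).take n).foldl (fun μ t => μ.bind (forwardStep M G x t)) (Measure.dirac (0, 0))

theorem forwardPrefix_succ (x : Fin T → Pt D) (t : Fin T) :
    forwardPrefix N M G x (t + 1) = (forwardPrefix N M G x t).bind (forwardStep M G x t) := by
  rw [forwardPrefix, take_finRange_succ, List.foldl_append]
  rfl

theorem forwardPrefix_length (x : Fin T → Pt D) :
    forwardPrefix N M G x T = forwardLaw N M G x := by
  rw [forwardPrefix, List.take_of_length_le (by simp), forwardLaw]

theorem forwardStep_congr {x y : Fin T → Pt D} {t : Fin T} (hxy : x t = y t)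
    (s : (Fin T → Fin (N + 1)) × Particles T D N) :
    forwardStep M G x t s = forwardStep M G y t s := by
  unfold forwardStep
  rw [hxy]

/-- The first `n` steps read only the reference states before time `n`, so `x_t` can be integrated
before the earlier states. -/
theorem forwardPrefix_update (x : Fin T → Pt D) (t : Fin T) (z : Pt D) {n : ℕ} (hn : n ≤ t) :
    forwardPrefix N M G (Function.update x t z) n = forwardPrefix N M G x n := by
  induction n with
  | zero => simp only [forwardPrefix, List.take_zero, List.foldl_nil]
  | succ n ih =>
    obtain ⟨s, rfl⟩ : ∃ s : Fin T, s.val = n := ⟨⟨n, by omega⟩, rfl⟩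
    rw [forwardPrefix_succ, forwardPrefix_succ, ih (by omega)]
    have hne : s ≠ t := Fin.ne_of_val_ne (by omega)
    exact congrArg _ (funext (forwardStep_congr (Function.update_of_ne hne _ _)))

variable (M G) in
/-- The product of the path densities before time `n`. -/
def pathDensityBefore (n : ℕ) (x : Fin T → Pt D) : ℝ :=
  ∏ t ∈ Finset.univ.filter (fun t : Fin T => t.val < n), stepDensity M G t (lag2 x t) (lag1 x t) (x t)

theorem filter_lt_succ (t : Fin T) : Finset.univ.filter (fun s : Fin T => s.val < t.val + 1) =
    insert t (Finset.univ.filter fun s : Fin T => s.val < t.val) := by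
  ext s
  simp only [Finset.mem_filter, Finset.mem_univ, true_and, Finset.mem_insert, Fin.ext_iff]
  omega

theorem pathDensityBefore_succ_update (x : Fin T → Pt D) (t : Fin T) (z : Pt D) :
    pathDensityBefore M G (t + 1) (Function.update x t z) =
      pathDensityBefore M G t x * stepDensity M G t (lag2 x t) (lag1 x t) z := by
  rw [pathDensityBefore, filter_lt_succ, Finset.prod_insert (by simp), mul_comm,
    lag1_update x le_rfl, lag2_update x le_rfl, Function.update_self, pathDensityBefore]
  congr 1
  refine Finset.prod_congr rfl fun s hs => ?_
  have hlt : s < t := by simpa using hs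
  rw [lag1_update x hlt.le, lag2_update x hlt.le, Function.update_of_ne hlt.ne]

theorem measurable_pathStep (h : Regular (fun _ : Unit => M) fun _ => G) (t : Fin T) :
    Measurable fun x : Fin T → Pt D => stepDensity M G t (lag2 x t) (lag1 x t) (x t) :=
  h.measurable_stepDensity t (u := fun _ => ()) measurable_const (measurable_lag2 t)
    (measurable_lag1 t) (measurable_pi_apply t)

theorem pathDensityBefore_nonneg (h : Regular (fun _ : Unit => M) fun _ => G) (n : ℕ)
    (x : Fin T → Pt D) : 0 ≤ pathDensityBefore M G n x :=
  Finset.prod_nonneg fun t _ => (h.step_pos () x t).le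

theorem measurable_pathDensityBefore (h : Regular (fun _ : Unit => M) fun _ => G) (n : ℕ) :
    Measurable (pathDensityBefore M G n) :=
  Finset.measurable_prod _ fun t _ => measurable_pathStep h t

/-- The joint law of the reference path, the last reference index and the particle system,
expressed through the unconditional particle system. -/
theorem lmarginal_forwardPrefix (h : Regular (fun _ : Unit => M) fun _ => G) {n : ℕ} (hn : n ≤ T)
    {f : Fin (N + 1) × Particles T D N × Pt D × Pt D → ENNReal} (hf : Measurable f) :
    lmarginal (fun _ => volume) (Finset.univ.filter fun t : Fin T => t.val < n)
      (fun x => ENNReal.ofReal (pathDensityBefore M G n x) *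
        ∫⁻ s, f (prev s.1 n, s.2, prev x n, prev (lag1 x) n) ∂forwardPrefix N M G x n) 0 =
    particleExpectation M G n fun S => ∑ i, ENNReal.ofReal (ancestorWeight G S n i) *
      f (i, S, prevState S n i, prevParent S n i) := by
  -- The test function must vary: integrating out the last step turns `f` into another function of
  -- the same kind. The base point `0` is immaterial, as only coordinates before `n` are read.
  induction n generalizing f with
  | zero =>
    have e : (Finset.univ.filter fun t : Fin T => t.val < 0) = ∅ := by simp
    rw [e, lmarginal_empty]
    simp only [pathDensityBefore, forwardPrefix, List.take_zero, List.foldl_nil, prev]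
    have hm : Measurable fun s : (Fin T → Fin (N + 1)) × Particles T D N =>
        f (0, s.2, 0, 0) := hf.comp (by fun_prop)
    rw [lintegral_dirac' _ hm]
    simp only [particleExpectation, ancestorWeight, prevState, prevParent]
    rw [Finset.sum_eq_single 0 (fun i _ hi => by simp [hi]) (by simp)]
    simp
  | succ n ih =>
    obtain ⟨t, rfl⟩ : ∃ t : Fin T, t.val = n := ⟨⟨n, hn⟩, rfl⟩
    have hpre : MarkovFamily fun x : Fin T → Pt D => forwardPrefix N M G x (t + 1) :=
      h.forwardFold _ (u := fun _ => ()) measurable_const measurable_id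
    have hprop : MarkovFamily fun q : Fin (N + 1) × Particles T D N × Pt D × Pt D =>
        proposalLaw M G q.2.1 t :=
      h.proposalLaw t (u := fun _ => ()) measurable_const measurable_snd.fst
    -- one step of the forward pass, in terms of the previous reference index and state
    set H : Fin (N + 1) × Particles T D N × Pt D × Pt D → ENNReal := fun q =>
      ∑ j : Fin (N + 1), ENNReal.ofReal (1 / ((N : ℝ) + 1)) *
        ∫⁻ g, f (j, Function.update q.2.1 t g, q.2.2.1, q.2.2.2)
          ∂Measure.pi fun n : Fin (N + 1) => if n = j then
            Measure.dirac (q.1, q.2.2.1) else proposalLaw M G q.2.1 t with hH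
    have hHm : Measurable H := by
      refine Finset.measurable_sum _ fun j _ => Measurable.const_mul ?_ _
      refine (hprop.pi_replace (r := fun q => (q.1, q.2.2.1)) (j := fun _ => j)
        (measurable_fst.prodMk measurable_snd.snd.fst) measurable_const).measurable_lintegral
        (f := fun q g => f (j, Function.update q.2.1 t g, q.2.2.1, q.2.2.2)) ?_
      have hu : Measurable fun p : (Fin (N + 1) × Particles T D N × Pt D × Pt D) ×
          (Fin (N + 1) → Fin (N + 1) × Pt D) => Function.update p.1.2.1 t p.2 :=
        measurable_update'.comp (measurable_fst.snd.fst.prodMk measurable_snd)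
      exact hf.comp (measurable_const.prodMk (hu.prodMk
        (measurable_fst.snd.snd.fst.prodMk measurable_fst.snd.snd.snd)))
    -- The arguments shift by one time: `q` holds `x_{t-1}` and `x_{t-2}`, while `H` receives the
    -- new state `z = x_t` followed by `x_{t-1}`.
    set f' : Fin (N + 1) × Particles T D N × Pt D × Pt D → ENNReal := fun q =>
      ∫⁻ z, ENNReal.ofReal (stepDensity M G t q.2.2.2 q.2.2.1 z) * H (q.1, q.2.1, z, q.2.2.1)
      with hf'
    have hf'int : Measurable fun p : (Fin (N + 1) × Particles T D N × Pt D × Pt D) × Pt D =>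
        ENNReal.ofReal (stepDensity M G t p.1.2.2.2 p.1.2.2.1 p.2) *
          H (p.1.1, p.1.2.1, p.2, p.1.2.2.1) :=
      (h.measurable_stepDensity t (u := fun _ => ()) measurable_const measurable_fst.snd.snd.snd
        measurable_fst.snd.snd.fst measurable_snd).ennreal_ofReal.mul
        (hHm.comp (measurable_fst.fst.prodMk (measurable_fst.snd.fst.prodMk
          (measurable_snd.prodMk measurable_fst.snd.snd.fst))))
    have hf'm : Measurable f' := hf'int.lintegral_prod_right'
    have hint : Measurable fun x : Fin T → Pt D =>
        ENNReal.ofReal (pathDensityBefore M G (t + 1) x) * ∫⁻ s, f (prev s.1 (t + 1), s.2,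
          prev x (t + 1), prev (lag1 x) (t + 1)) ∂forwardPrefix N M G x (t + 1) := by
      refine (measurable_pathDensityBefore h _).ennreal_ofReal.mul
        (hpre.measurable_lintegral (f := fun x s => f (prev s.1 (t + 1), s.2,
          prev x (t + 1), prev (lag1 x) (t + 1))) ?_)
      refine hf.comp ((measurable_prev _ measurable_snd.fst).prodMk
        (measurable_snd.snd.prodMk ((measurable_prev _ measurable_fst).prodMk ?_)))
      simp_rw [prev_succ]
      exact (measurable_lag1 t).comp measurable_fst
    rw [filter_lt_succ, lmarginal_insert' _ hint (by simp), particleExpectation_succ]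
    have hstep : ∀ x : Fin T → Pt D, (∫⁻ z, ENNReal.ofReal (pathDensityBefore M G (t + 1)
        (Function.update x t z)) * ∫⁻ s, f (prev s.1 (t + 1), s.2,
          prev (Function.update x t z) (t + 1), prev (lag1 (Function.update x t z)) (t + 1))
          ∂forwardPrefix N M G (Function.update x t z) (t + 1)) =
        ENNReal.ofReal (pathDensityBefore M G t x) *
        ∫⁻ s, f' (prev s.1 t, s.2, prev x t, prev (lag1 x) t) ∂forwardPrefix N M G x t := by
      intro x
      have hm : ∀ z, Measurable fun s : (Fin T → Fin (N + 1)) × Particles T D N =>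
          f (prev s.1 (t + 1), s.2, z, lag1 x t) := fun z =>
        hf.comp ((measurable_prev _ measurable_fst).prodMk
          (measurable_snd.prodMk (measurable_const.prodMk measurable_const)))
      have hmH : Measurable fun p : Pt D × ((Fin T → Fin (N + 1)) × Particles T D N) =>
          H (prev p.2.1 t, p.2.2, p.1, lag1 x t) :=
        hHm.comp ((measurable_prev _ measurable_snd.fst).prodMk
          (measurable_snd.snd.prodMk (measurable_fst.prodMk measurable_const)))
      have hpt : MarkovFamily fun x : Fin T → Pt D => forwardPrefix N M G x t :=
        h.forwardFold _ (u := fun _ => ()) measurable_const measurable_id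
      have := hpt.isProb x
      have hz : ∀ z, ENNReal.ofReal (pathDensityBefore M G (t + 1)
          (Function.update x t z)) * (∫⁻ s, f (prev s.1 (t + 1), s.2,
          prev (Function.update x t z) (t + 1), prev (lag1 (Function.update x t z)) (t + 1))
          ∂forwardPrefix N M G (Function.update x t z) (t + 1)) =
          ENNReal.ofReal (pathDensityBefore M G t x) *
          ∫⁻ s, ENNReal.ofReal (stepDensity M G t (lag2 x t) (lag1 x t) z) *
            H (prev s.1 t, s.2, z, lag1 x t) ∂forwardPrefix N M G x t := by
        intro z
        have hfs : MarkovFamily fun s : (Fin T → Fin (N + 1)) × Particles T D N =>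
            forwardStep M G (Function.update x t z) t s :=
          h.forwardStep t (u := fun _ => ()) measurable_const measurable_const measurable_id
        rw [pathDensityBefore_succ_update, ENNReal.ofReal_mul (pathDensityBefore_nonneg h _ _),
          mul_assoc, lintegral_const_mul' _ _ ENNReal.ofReal_ne_top, forwardPrefix_succ,
          forwardPrefix_update x t z le_rfl]
        congr 2
        simp only [prev_succ, Function.update_self, lag1_update x le_rfl]
        have hm' := hm z
        simp only [prev_succ] at hm'
        rw [Measure.lintegral_bind hfs.measurable.aemeasurable hm'.aemeasurable]
        refine lintegral_congr fun s => ?_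
        rw [lintegral_forwardStep _ _ _ hm']
        simp only [hH, Function.update_self]
      simp_rw [hz]
      rw [lintegral_const_mul' _ _ ENNReal.ofReal_ne_top]
      congr 1
      rw [lintegral_lintegral_swap]
      · simp only [hf', lag1_eq, lag2_eq]
      · refine Measurable.aemeasurable (Measurable.mul ?_ hmH)
        exact (h.measurable_stepDensity t (u := fun _ => ()) measurable_const measurable_const
          measurable_const measurable_fst).ennreal_ofReal
    simp_rw [hstep]
    -- After the induction hypothesis both sides are expectations over the particles before `t`, and
    -- their integrands agree by the many-to-one formula.
    rw [ih (by omega) hf'm]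
    congr 1
    funext S
    refine (particleStep_sum_weight h t S
      (f := fun j p g => f (j, Function.update S t g, p.2, prevState S t p.1)) (fun j => ?_)
      (fun g => ?_)).symm
    · have hu : Measurable fun p : (Fin (N + 1) × Pt D) × (Fin (N + 1) → Fin (N + 1) × Pt D) =>
          Function.update S t p.2 := (measurable_update S).comp measurable_snd
      exact hf.comp (measurable_const.prodMk (hu.prodMk (measurable_fst.snd.prodMk
        (measurable_prevState t measurable_const measurable_fst.fst))))
    · refine Finset.sum_congr rfl fun j _ => ?_
      rw [ancestorWeight_succ, prevState_succ, prevParent_succ, parent_update_self,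
        Function.update_self]

end ForwardIdentity

/-! ### The forced move and the backward pass -/

section Backward

variable {T D N : ℕ} {M : Fin T → Pt D → Pt D → ℝ} {G : Fin T → Pt D → Pt D → Pt D → ℝ}

/-- The forced move is reversible with respect to `W`. -/
theorem forcedMove_detailed_balance {a b : ℝ} (ha : a < 1) (hb : b < 1) :
    a * (b / (1 - a)) * min 1 ((1 - a) / (1 - b)) =
      b * (a / (1 - b)) * min 1 ((1 - b) / (1 - a)) := by
  have ha' : 0 < 1 - a := by linarith
  have hb' : 0 < 1 - b := by linarith
  -- In either case both sides equal `a * b / max (1 - a) (1 - b)`.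
  rcases le_total a b with h | h
  · rw [min_eq_left ((one_le_div hb').mpr (by linarith)),
      min_eq_right ((div_le_one ha').mpr (by linarith))]
    field_simp
  · rw [min_eq_right ((div_le_one hb').mpr (by linarith)),
      min_eq_left ((one_le_div ha').mpr (by linarith))]
    field_simp

/-- The forced move leaves `W` invariant. -/
theorem sum_forcedMove (hN : 1 ≤ N) {W : Fin (N + 1) → ℝ} (hW : ∀ i, 0 < W i)
    (h1 : ∑ i, W i = 1) (f : Fin (N + 1) → ENNReal) :
    ∑ k, ENNReal.ofReal (W k) * ∫⁻ l, f l ∂forcedMove W k = ∑ i, ENNReal.ofReal (W i) * f i := by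
  have hlt := fun k => (sum_forcedMove_proposal hN hW h1 k).1
  set p : Fin (N + 1) → Fin (N + 1) → ℝ := fun k i => if i = k then 0 else W i / (1 - W k) with hp
  set m : Fin (N + 1) → Fin (N + 1) → ℝ := fun k i => min 1 ((1 - W k) / (1 - W i)) with hm
  have hp0 : ∀ k i, 0 ≤ p k i := fun k i => by
    simp only [hp]
    split_ifs
    · exact le_rfl
    · exact div_nonneg (hW i).le (by linarith [hlt k])
  have hm0 : ∀ k i, 0 ≤ m k i := fun k i =>
    le_min zero_le_one (div_nonneg (by linarith [hlt k]) (by linarith [hlt i]))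
  have hm1 : ∀ k i, 0 ≤ 1 - m k i := fun k i => sub_nonneg.mpr (min_le_left _ _)
  have hbal : ∀ k i, W k * (p k i * m k i) = W i * (p i k * m i k) := fun k i => by
    by_cases hki : i = k
    · rw [hki]
    · simp only [hp, hm, if_neg hki, if_neg (Ne.symm hki), ← mul_assoc]
      exact forcedMove_detailed_balance (hlt k) (hlt i)
  have hsplit : ∀ k, ENNReal.ofReal (W k) * ∫⁻ l, f l ∂forcedMove W k =
      ∑ i, ENNReal.ofReal (W k * (p k i * m k i)) * f i +
        ∑ i, ENNReal.ofReal (W k * (p k i * (1 - m k i))) * f k := fun k => by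
    rw [lintegral_forcedMove, Finset.mul_sum, ← Finset.sum_add_distrib]
    refine Finset.sum_congr rfl fun i _ => ?_
    rw [ENNReal.ofReal_mul (hW k).le, ENNReal.ofReal_mul (hW k).le, ENNReal.ofReal_mul (hp0 k i),
      ENNReal.ofReal_mul (hp0 k i)]
    ring
  simp_rw [hsplit]
  rw [Finset.sum_add_distrib, Finset.sum_comm, ← Finset.sum_add_distrib]
  refine Finset.sum_congr rfl fun i _ => ?_
  rw [← Finset.sum_add_distrib]
  -- By detailed balance the mass accepted from `k` into `i` equals that accepted from `i` into `k`.
  -- Together with the mass that stays at `i` after rejecting `k`, it is the whole mass proposed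
  -- from `i` to `k`.
  have : ∀ k, ENNReal.ofReal (W k * (p k i * m k i)) * f i +
      ENNReal.ofReal (W i * (p i k * (1 - m i k))) * f i =
      ENNReal.ofReal (W i * p i k) * f i := fun k => by
    rw [hbal, ← add_mul, ← ENNReal.ofReal_add (mul_nonneg (hW i).le (mul_nonneg (hp0 i k) (hm0 i k)))
      (mul_nonneg (hW i).le (mul_nonneg (hp0 i k) (hm1 i k)))]
    congr 2
    ring
  simp_rw [this]
  rw [← Finset.sum_mul, ← ENNReal.ofReal_sum_of_nonneg fun k _ => mul_nonneg (hW i).le (hp0 i k),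
    ← Finset.mul_sum, (sum_forcedMove_proposal hN hW h1 i).2, mul_one]

/-! ### Future densities and backward weights -/

variable (M G) in
/-- The product of the path densities from time `n` on. -/
def pathDensityFrom (n : ℕ) (y : Fin T → Pt D) : ℝ :=
  ∏ s ∈ Finset.univ.filter (fun s : Fin T => n ≤ s.val), stepDensity M G s (lag2 y s) (lag1 y s) (y s)

theorem filter_le_eq_insert (t : Fin T) : Finset.univ.filter (fun s : Fin T => t.val ≤ s.val) =
    insert t (Finset.univ.filter fun s : Fin T => t.val + 1 ≤ s.val) := by
  ext s
  simp only [Finset.mem_filter, Finset.mem_univ, true_and, Finset.mem_insert, Fin.ext_iff]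
  omega

theorem filter_le_eq_empty {n : ℕ} (hn : T ≤ n) :
    Finset.univ.filter (fun s : Fin T => n ≤ s.val) = ∅ := by
  ext s
  simp
  omega

theorem pathDensityFrom_eq_mul (t : Fin T) (y : Fin T → Pt D) : pathDensityFrom M G t y =
    stepDensity M G t (lag2 y t) (lag1 y t) (y t) * pathDensityFrom M G (t + 1) y := by
  rw [pathDensityFrom, filter_le_eq_insert, Finset.prod_insert (by simp)]
  rfl

theorem pathDensityFrom_of_le {n : ℕ} (hn : T ≤ n) (y : Fin T → Pt D) :
    pathDensityFrom M G n y = 1 := by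
  rw [pathDensityFrom, filter_le_eq_empty hn, Finset.prod_empty]

/-- The model has order two, so the factors from time `n` on read no state before `n - 2`. -/
theorem pathDensityFrom_congr {n : ℕ} {y y' : Fin T → Pt D}
    (hy : ∀ s : Fin T, n ≤ s.val + 2 → y s = y' s) :
    pathDensityFrom M G n y = pathDensityFrom M G n y' := by
  refine Finset.prod_congr rfl fun s hs => ?_
  have hs' : n ≤ s.val := by simpa using hs
  have h1 : lag1 y s = lag1 y' s := by
    unfold lag1
    split_ifs with h
    · exact hy _ (by simp [before]; omega)
    · rfl
  have h2 : lag2 y s = lag2 y' s := by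
    unfold lag2
    split_ifs with h
    · exact hy _ (by simp [before]; omega)
    · rfl
  rw [h1, h2, hy s (by omega)]

theorem pathDensityFrom_pos (h : Regular (fun _ : Unit => M) fun _ => G) (n : ℕ)
    (y : Fin T → Pt D) : 0 < pathDensityFrom M G n y :=
  Finset.prod_pos fun t _ => h.step_pos () y t

theorem measurable_pathDensityFrom (h : Regular (fun _ : Unit => M) fun _ => G) (n : ℕ) :
    Measurable (pathDensityFrom M G n) :=
  Finset.measurable_prod _ fun t _ => measurable_pathStep h t

/-- The path `y` with the states at times `n - 2` and `n - 1` replaced by `z₂` and `z₁`. -/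
def attach (n : ℕ) (z₂ z₁ : Pt D) (y : Fin T → Pt D) : Fin T → Pt D :=
  fun s => if s.val + 1 = n then z₁ else if s.val + 2 = n then z₂ else y s

theorem measurable_attach {α : Type*} [MeasurableSpace α] (n : ℕ) {z₂ z₁ : α → Pt D}
    {y : α → Fin T → Pt D} (h₂ : Measurable z₂) (h₁ : Measurable z₁) (hy : Measurable y) :
    Measurable fun a => attach n (z₂ a) (z₁ a) (y a) := by
  refine measurable_pi_lambda _ fun s => ?_
  simp only [attach]
  split_ifs
  · exact h₁
  · exact h₂
  · exact (measurable_pi_apply s).comp hy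

theorem attach_of_le {n : ℕ} (z₂ z₁ : Pt D) (y : Fin T → Pt D) {s : Fin T} (hs : n ≤ s.val) :
    attach n z₂ z₁ y s = y s := by
  rw [attach, if_neg (by omega), if_neg (by omega)]

/-- When no time precedes `t`, nothing is attached and the lag is the dummy `0`; the hypothesis on
`z₁` covers this case. -/
theorem lag1_attach (t : Fin T) (z₂ : Pt D) {z₁ : Pt D} (y : Fin T → Pt D)
    (h₁ : t.val < 1 → z₁ = 0) : lag1 (attach t z₂ z₁ y) t = z₁ := by
  unfold lag1
  split_ifs with h
  · rw [attach, if_pos (by simp [before]; omega)]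
  · exact (h₁ (by omega)).symm

theorem lag2_attach (t : Fin T) {z₂ : Pt D} (z₁ : Pt D) (y : Fin T → Pt D)
    (h₂ : t.val < 2 → z₂ = 0) : lag2 (attach t z₂ z₁ y) t = z₂ := by
  unfold lag2
  split_ifs with h
  · rw [attach, if_neg (by simp [before]; omega), if_pos (by simp [before]; omega)]
  · exact (h₂ (by omega)).symm

/-- After the factor at `t` is split off, the two attached paths can differ only before `t - 1`,
where the remaining factors do not look. -/
theorem pathDensityFrom_attach (t : Fin T) {z₂ z₁ : Pt D} (y : Fin T → Pt D)
    (h₂ : t.val < 2 → z₂ = 0) (h₁ : t.val < 1 → z₁ = 0) :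
    pathDensityFrom M G t (attach t z₂ z₁ y) = stepDensity M G t z₂ z₁ (y t) *
      pathDensityFrom M G (t + 1) (attach (t + 1) z₁ (y t) y) := by
  rw [pathDensityFrom_eq_mul, lag1_attach t z₂ y h₁, lag2_attach t z₁ y h₂, attach_of_le _ _ _ le_rfl]
  congr 1
  refine pathDensityFrom_congr fun s hs => ?_
  simp only [attach]
  by_cases h1 : s.val = t.val
  · have : s = t := Fin.ext h1
    subst this
    simp
  · by_cases h2 : s.val + 1 = t.val
    · simp [h2]
    · rw [if_neg h2, if_neg (by omega), if_neg (by omega), if_neg (by omega)]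

theorem parent_eq_zero (S : Particles T D N) {t : Fin T} (ht : t.val < 1) (i : Fin (N + 1)) :
    parent S t i = 0 := by
  rw [parent, if_neg (by omega)]

theorem prevState_eq_zero (S : Particles T D N) {n : ℕ} (hn : n < 1) (i : Fin (N + 1)) :
    prevState S n i = 0 := by
  obtain rfl : n = 0 := by omega
  rfl

theorem prevParent_eq_zero (S : Particles T D N) {n : ℕ} (hn : n < 2) (i : Fin (N + 1)) :
    prevParent S n i = 0 := by
  obtain _ | n := n
  · rfl
  · simp only [prevParent]
    split_ifs
    · exact parent_eq_zero S (show n < 1 by omega) i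
    · rfl

variable (M G) in
/-- The backward-sampling weights at time `t`, with the whole future density. -/
def futureWeight (S : Particles T D N) (t : Fin T) (y : Fin T → Pt D) (i : Fin (N + 1)) : ℝ :=
  weight G S t i * pathDensityFrom M G (t + 1) (attach (t + 1) (parent S t i) (S t i).2 y)

theorem futureWeight_pos (h : Regular (fun _ : Unit => M) fun _ => G) (S : Particles T D N)
    (t : Fin T) (y : Fin T → Pt D) (i : Fin (N + 1)) : 0 < futureWeight M G S t y i :=
  mul_pos (h.weight_pos () S t i) (pathDensityFrom_pos h _ _)

theorem measurable_futureWeight (h : Regular (fun _ : Unit => M) fun _ => G) (S : Particles T D N)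
    (t : Fin T) : Measurable (futureWeight M G S t) :=
  measurable_pi_lambda _ fun _ => ((measurable_pathDensityFrom h _).comp
    (measurable_attach _ measurable_const measurable_const measurable_id)).const_mul _

/-- The path of states selected by the indices `l`. -/
def selectPath (S : Particles T D N) (l : Fin T → Fin (N + 1)) : Fin T → Pt D :=
  fun t => (S t (l t)).2

theorem selectPath_update (S : Particles T D N) (l : Fin T → Fin (N + 1)) (t : Fin T)
    (i : Fin (N + 1)) : selectPath S (Function.update l t i) =
      Function.update (selectPath S l) t (S t i).2 := by
  ext s : 1
  by_cases hs : s = t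
  · subst hs
    simp [selectPath]
  · simp [selectPath, Function.update_of_ne hs]

/-- Only the factors at `t + 1` and `t + 2` involve the lineage `i`. Those from `t + 3` on are
common to all indices and cancel on normalisation. -/
theorem normalise_backwardWeight (h : Regular (fun _ : Unit => M) fun _ => G)
    (S : Particles T D N) (l : Fin T → Fin (N + 1)) (t : Fin T) (h1 : t.val + 1 < T) :
    normalise (backwardWeight M G S l t h1) =
      normalise (futureWeight M G S t (selectPath S l)) := by
  rw [← normalise_const_mul (pathDensityFrom_pos h (t + 3) (selectPath S l)).ne']
  congr 1
  ext i
  have e1 := pathDensityFrom_attach (M := M) (G := G) ⟨t.val + 1, h1⟩ (selectPath S l)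
    (z₂ := parent S t i) (z₁ := (S t i).2)
    (fun ht => parent_eq_zero S (by simp at ht; omega) i) (by simp)
  simp only at e1
  rw [futureWeight, e1, backwardWeight]
  by_cases h2 : t.val + 2 < T
  · have e2 := pathDensityFrom_attach (M := M) (G := G) ⟨t.val + 2, h2⟩ (selectPath S l)
      (z₂ := (S t i).2) (z₁ := selectPath S l ⟨t.val + 1, h1⟩) (by simp) (by simp)
    simp only at e2
    -- The attached states are the ones the selected path already has.
    have e3 : attach (t.val + 2 + 1) (selectPath S l ⟨t.val + 1, h1⟩)
        (selectPath S l ⟨t.val + 2, h2⟩) (selectPath S l) = selectPath S l := by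
      ext s : 1
      simp only [attach]
      split_ifs with ha hb
      · congr 1
        exact Fin.ext (by simp; omega)
      · congr 1
        exact Fin.ext (by simp; omega)
      · rfl
    rw [show t.val + 1 + 1 = t.val + 2 from rfl, e2, e3, dif_pos h2]
    simp only [selectPath]
    ring
  -- Here `t + 2 = T`, so both remaining products are empty.
  · rw [dif_neg h2, pathDensityFrom_of_le (by omega), pathDensityFrom_of_le (by omega)]
    simp only [selectPath]
    ring

theorem normalise_futureWeight_last (h : Regular (fun _ : Unit => M) fun _ => G)
    (S : Particles T D N) {t : Fin T} (ht : t.val + 1 = T) (y : Fin T → Pt D) :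
    normalise (futureWeight M G S t y) = weight G S t := by
  ext i
  simp only [normalise, futureWeight, pathDensityFrom_of_le ht.ge, mul_one]
  rw [h.sum_weight () S t, div_one]

/-! ### The expected value of the backward pass -/

variable (M G) in
/-- The expected value of `f` at the end of the backward pass, when the states of `y` have been
selected at the times from `n` on. -/
def backwardValue (f : (Fin T → Pt D) → ENNReal) (S : Particles T D N) :
    ℕ → (Fin T → Pt D) → ENNReal
  | 0, y => f y
  | n + 1, y => if h : n < T then ∑ i, ENNReal.ofReal (normalise (futureWeight M G S ⟨n, h⟩ y) i) *
      backwardValue f S n (Function.update y ⟨n, h⟩ (S ⟨n, h⟩ i).2) else 0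

theorem backwardValue_succ (f : (Fin T → Pt D) → ENNReal) (S : Particles T D N) (t : Fin T)
    (y : Fin T → Pt D) : backwardValue M G f S (t + 1) y =
      ∑ i, ENNReal.ofReal (normalise (futureWeight M G S t y) i) *
        backwardValue M G f S t (Function.update y t (S t i).2) := by
  simp [backwardValue]

theorem measurable_backwardValue (h : Regular (fun _ : Unit => M) fun _ => G)
    {f : (Fin T → Pt D) → ENNReal} (hf : Measurable f) (S : Particles T D N) {n : ℕ} (hn : n ≤ T) :
    Measurable (backwardValue M G f S n) := by
  induction n with
  | zero => exact hf
  | succ n ih =>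
    obtain ⟨t, rfl⟩ : ∃ t : Fin T, t.val = n := ⟨⟨n, hn⟩, rfl⟩
    simp only [funext (backwardValue_succ (M := M) (G := G) f S t)]
    exact Finset.measurable_sum _ fun i _ => ((measurable_pi_apply i).comp
      (measurable_normalise (measurable_futureWeight h S t))).ennreal_ofReal.mul
      ((ih (by omega)).comp measurable_update_left)

theorem futureWeight_congr (S : Particles T D N) (t : Fin T) {y y' : Fin T → Pt D}
    (hy : ∀ s : Fin T, t.val + 1 ≤ s.val → y s = y' s) :
    futureWeight M G S t y = futureWeight M G S t y' := by
  ext i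
  simp only [futureWeight]
  congr 1
  refine pathDensityFrom_congr fun s hs => ?_
  simp only [attach]
  split_ifs
  · rfl
  · rfl
  · exact hy s (by omega)

/-- States before time `n` are still to be selected and will overwrite whatever `y` holds there. -/
theorem backwardValue_congr (f : (Fin T → Pt D) → ENNReal) (S : Particles T D N) {n : ℕ}
    (hn : n ≤ T) {y y' : Fin T → Pt D} (hy : ∀ s : Fin T, n ≤ s.val → y s = y' s) :
    backwardValue M G f S n y = backwardValue M G f S n y' := by
  induction n generalizing y y' with
  | zero => exact congrArg f (funext fun s => hy s (Nat.zero_le _))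
  | succ n ih =>
    obtain ⟨t, rfl⟩ : ∃ t : Fin T, t.val = n := ⟨⟨n, hn⟩, rfl⟩
    rw [backwardValue_succ, backwardValue_succ, futureWeight_congr S t hy]
    refine Finset.sum_congr rfl fun i _ => ?_
    rw [ih (by omega)]
    intro s hs
    by_cases hst : s = t
    · subst hst
      simp
    · rw [Function.update_of_ne hst, Function.update_of_ne hst]
      refine hy s ?_
      have := Fin.val_ne_of_ne hst
      omega

theorem futureWeight_update (S : Particles T D N) {s t : Fin T} (hs : s < t)
    (g : Fin (N + 1) → Fin (N + 1) × Pt D) (y : Fin T → Pt D) :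
    futureWeight M G (Function.update S t g) s y = futureWeight M G S s y := by
  ext i
  rw [futureWeight, futureWeight, weight_update_of_lt S hs, parent_update_of_lt S hs,
    Function.update_of_ne hs.ne]

/-- The steps before time `n` use only generations before `n`. -/
theorem backwardValue_update (f : (Fin T → Pt D) → ENNReal) (S : Particles T D N) {t : Fin T}
    {n : ℕ} (hn : n ≤ t) (g : Fin (N + 1) → Fin (N + 1) × Pt D) (y : Fin T → Pt D) :
    backwardValue M G f (Function.update S t g) n y = backwardValue M G f S n y := by
  induction n generalizing y with
  | zero => simp only [backwardValue]
  | succ n ih =>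
    obtain ⟨s, rfl⟩ : ∃ s : Fin T, s.val = n := ⟨⟨n, by omega⟩, rfl⟩
    have hs : s < t := hn
    rw [backwardValue_succ, backwardValue_succ, futureWeight_update S hs,
      Function.update_of_ne hs.ne]
    exact Finset.sum_congr rfl fun i _ => by rw [ih (by omega)]

variable (M G) in
/-- The law of the indices when the backward pass runs from `l` through the times before `n`. -/
def backwardSuffix (k : Fin T → Fin (N + 1)) (S : Particles T D N) (n : ℕ)
    (l : Fin T → Fin (N + 1)) : Measure (Fin T → Fin (N + 1)) :=
  ((List.finRange T).take n).reverse.foldl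
    (fun μ t => μ.bind fun l => (indexLaw M G k S t l).map fun i => Function.update l t i)
    (Measure.dirac l)

theorem lintegral_backwardSuffix_succ (h : Regular (fun _ : Unit => M) fun _ => G) (hN : 1 ≤ N)
    (k : Fin T → Fin (N + 1)) (S : Particles T D N) (t : Fin T) (l : Fin T → Fin (N + 1))
    (F : (Fin T → Fin (N + 1)) → ENNReal) :
    ∫⁻ l', F l' ∂backwardSuffix M G k S (t + 1) l =
      ∫⁻ i, ∫⁻ l', F l' ∂backwardSuffix M G k S t (Function.update l t i) ∂indexLaw M G k S t l := by
  have hstep : ∀ t : Fin T, MarkovFamily fun l : Fin T → Fin (N + 1) =>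
      (indexLaw M G k S t l).map fun i => Function.update l t i := fun t =>
    h.backwardStep hN t (u := fun _ => ()) measurable_const measurable_const measurable_const
      measurable_id
  rw [backwardSuffix, take_finRange_succ, List.reverse_append, List.reverse_singleton,
    List.singleton_append, List.foldl_cons, foldl_bind_eq_bind hstep,
    Measure.dirac_bind (measurable_of_countable _),
    Measure.lintegral_bind (measurable_of_countable _).aemeasurable
      (measurable_of_countable _).aemeasurable,
    lintegral_map (measurable_of_countable _) (measurable_of_countable _)]
  rfl

/-- The restriction `n < T` excludes the last time, where the algorithm makes a forced move while
`backwardValue` draws directly from the weights. -/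
theorem lintegral_backwardSuffix (h : Regular (fun _ : Unit => M) fun _ => G) (hN : 1 ≤ N)
    (f : (Fin T → Pt D) → ENNReal) (k : Fin T → Fin (N + 1)) (S : Particles T D N) {n : ℕ}
    (hn : n < T) (l : Fin T → Fin (N + 1)) :
    ∫⁻ l', f (selectPath S l') ∂backwardSuffix M G k S n l =
      backwardValue M G f S n (selectPath S l) := by
  induction n generalizing l with
  | zero =>
    simp only [backwardSuffix, List.take_zero, List.reverse_nil, List.foldl_nil, backwardValue]
    exact lintegral_dirac _ _
  | succ n ih =>
    obtain ⟨t, rfl⟩ : ∃ t : Fin T, t.val = n := ⟨⟨n, by omega⟩, rfl⟩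
    rw [lintegral_backwardSuffix_succ h hN, indexLaw, dif_pos hn, lintegral_categorical,
      normalise_backwardWeight h, backwardValue_succ]
    refine Finset.sum_congr rfl fun i _ => ?_
    rw [ih (by omega), selectPath_update]

/-- The reference indices enter only through the last one, via the forced move. This is why the
forward identity need keep no other index. -/
theorem lintegral_backwardLaw (h : Regular (fun _ : Unit => M) fun _ => G) (hN : 1 ≤ N)
    (f : (Fin T → Pt D) → ENNReal) (s : (Fin T → Fin (N + 1)) × Particles T D N) {t : Fin T}
    (ht : t.val + 1 = T) :
    ∫⁻ l, f (selectPath s.2 l) ∂backwardLaw M G s =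
      ∫⁻ i, backwardValue M G f s.2 t (Function.update (selectPath s.2 0) t (s.2 t i).2)
        ∂forcedMove (weight G s.2 t) (s.1 t) := by
  have e : backwardLaw M G s = backwardSuffix M G s.1 s.2 (t + 1) 0 := by
    rw [backwardSuffix, List.take_of_length_le (by simp [ht]), backwardLaw]
  rw [e, lintegral_backwardSuffix_succ h hN, indexLaw, dif_neg (by omega)]
  refine lintegral_congr fun i => ?_
  rw [lintegral_backwardSuffix h hN f _ _ t.isLt, selectPath_update]

end Backward

/-! ### Invariance of conditional sequential Monte Carlo -/

section Invariance

variable {T D N : ℕ} {M : Fin T → Pt D → Pt D → ℝ} {G : Fin T → Pt D → Pt D → Pt D → ℝ}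

theorem ofReal_uniform_mul (c : ENNReal) :
    ∑ _j : Fin (N + 1), ENNReal.ofReal (1 / ((N : ℝ) + 1)) * c = c := by
  rw [Finset.sum_const, Finset.card_univ, Fintype.card_fin, nsmul_eq_mul, ← mul_assoc,
    ← ENNReal.ofReal_natCast, ← ENNReal.ofReal_mul (by positivity)]
  have : ((N + 1 : ℕ) : ℝ) * (1 / ((N : ℝ) + 1)) = 1 := by
    push_cast
    field_simp
  rw [this, ENNReal.ofReal_one, one_mul]

variable (M G) in
/-- The integral over the states from time `n` on of their density, given the states `z₂` and `z₁`
at the two preceding times, times the value of the rest of the backward pass. -/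
def futureIntegral (f : (Fin T → Pt D) → ENNReal) (S : Particles T D N) (n : ℕ) (z₂ z₁ : Pt D) :
    ENNReal :=
  lmarginal (fun _ => volume) (Finset.univ.filter fun s : Fin T => n ≤ s.val)
    (fun y => ENNReal.ofReal (pathDensityFrom M G n (attach n z₂ z₁ y)) *
      backwardValue M G f S n y) 0

theorem measurable_futureIntegrand (h : Regular (fun _ : Unit => M) fun _ => G)
    {f : (Fin T → Pt D) → ENNReal} (hf : Measurable f) (S : Particles T D N) {n : ℕ} (hn : n ≤ T)
    (z₂ z₁ : Pt D) : Measurable fun y => ENNReal.ofReal (pathDensityFrom M G n (attach n z₂ z₁ y)) *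
      backwardValue M G f S n y :=
  ((measurable_pathDensityFrom h n).comp
    (measurable_attach n measurable_const measurable_const measurable_id)).ennreal_ofReal.mul
    (measurable_backwardValue h hf S hn)

variable (M G) in
/-- As `futureIntegral`, after time `t`, with the state `z` selected at time `t`. -/
def selectedIntegral (f : (Fin T → Pt D) → ENNReal) (S : Particles T D N) (t : Fin T)
    (z₁ z : Pt D) : ENNReal :=
  lmarginal (fun _ => volume) (Finset.univ.filter fun s : Fin T => t.val + 1 ≤ s.val)
    (fun y => ENNReal.ofReal (pathDensityFrom M G (t + 1) (attach (t + 1) z₁ z y)) *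
      backwardValue M G f S t (Function.update y t z)) 0

theorem measurable_selectedIntegrand (h : Regular (fun _ : Unit => M) fun _ => G)
    {f : (Fin T → Pt D) → ENNReal} (hf : Measurable f) (S : Particles T D N) (t : Fin T) :
    Measurable fun p : (Pt D × Pt D) × (Fin T → Pt D) =>
      ENNReal.ofReal (pathDensityFrom M G (t + 1) (attach (t + 1) p.1.1 p.1.2 p.2)) *
        backwardValue M G f S t (Function.update p.2 t p.1.2) :=
  ((measurable_pathDensityFrom h _).comp
    (measurable_attach _ measurable_fst.fst measurable_fst.snd measurable_snd)).ennreal_ofReal.mul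
    ((measurable_backwardValue h hf S t.isLt.le).comp
      (measurable_update'.comp (measurable_snd.prodMk measurable_fst.snd)))

theorem measurable_selectedIntegral (h : Regular (fun _ : Unit => M) fun _ => G)
    {f : (Fin T → Pt D) → ENNReal} (hf : Measurable f) (S : Particles T D N) (t : Fin T) :
    Measurable fun p : Pt D × Pt D => selectedIntegral M G f S t p.1 p.2 := by
  simp only [selectedIntegral, lmarginal]
  have hu : Measurable fun q : (Pt D × Pt D) ×
      (∀ _ : Finset.univ.filter (fun s : Fin T => t.val + 1 ≤ s.val), Pt D) =>
      (q.1, Function.updateFinset (0 : Fin T → Pt D) _ q.2) :=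
    measurable_fst.prodMk (measurable_updateFinset.comp measurable_snd)
  exact ((measurable_selectedIntegrand h hf S t).comp hu).lintegral_prod_right'

/-- Tonelli with the state `z` at time `t` outermost; its factor `stepDensity` is constant in the
later states. -/
theorem futureIntegral_eq (h : Regular (fun _ : Unit => M) fun _ => G)
    {f : (Fin T → Pt D) → ENNReal} (hf : Measurable f) (S : Particles T D N) (t : Fin T)
    {z₂ z₁ : Pt D} (h₂ : t.val < 2 → z₂ = 0) (h₁ : t.val < 1 → z₁ = 0) :
    futureIntegral M G f S t z₂ z₁ =
      ∫⁻ z, ENNReal.ofReal (stepDensity M G t z₂ z₁ z) * selectedIntegral M G f S t z₁ z := by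
  have hm := measurable_futureIntegrand h hf S t.isLt.le z₂ z₁
  rw [futureIntegral, filter_le_eq_insert, lmarginal_insert _ hm (by simp)]
  refine lintegral_congr fun z => ?_
  rw [lmarginal_update_of_notMem hm (by simp), selectedIntegral, lmarginal, lmarginal,
    ← lintegral_const_mul' _ _ ENNReal.ofReal_ne_top]
  refine lintegral_congr fun y => ?_
  rw [Function.comp_apply, pathDensityFrom_attach t _ h₂ h₁, Function.update_self,
    ENNReal.ofReal_mul (h.stepDensity_pos () t _ h₂ h₁).le, mul_assoc]
  -- The paths differ only at `t`, and attaching at `t + 1` overwrites that coordinate.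
  congr 3
  refine pathDensityFrom_congr fun s _ => ?_
  simp only [attach]
  split_ifs with hs
  · rfl
  · rfl
  · exact Function.update_of_ne (fun e => hs (by rw [e])) _ _

/-- For each fixed future, the lineage weights times the future density sum to the normalising
constant of the backward weights. It cancels with the denominator in `backwardValue`. -/
theorem sum_futureIntegral_succ (h : Regular (fun _ : Unit => M) fun _ => G)
    {f : (Fin T → Pt D) → ENNReal} (hf : Measurable f) (S : Particles T D N) (t : Fin T) :
    ∑ i, ENNReal.ofReal (ancestorWeight G S (t + 1) i) *
        futureIntegral M G f S (t + 1) (prevParent S (t + 1) i) (prevState S (t + 1) i) =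
      ∑ j, ENNReal.ofReal (weight G S t j) *
        selectedIntegral M G f S t (parent S t j) (S t j).2 := by
  have hn : t.val + 1 ≤ T := t.isLt
  simp only [ancestorWeight_succ, prevParent_succ, prevState_succ, futureIntegral, selectedIntegral,
    lmarginal]
  simp_rw [← lintegral_const_mul' _ _ ENNReal.ofReal_ne_top]
  have hA : ∀ i, Measurable fun y' : (∀ _ : Finset.univ.filter (fun s : Fin T =>
      t.val + 1 ≤ s.val), Pt D) => ENNReal.ofReal (weight G S t i) *
      (ENNReal.ofReal (pathDensityFrom M G (t + 1) (attach (t + 1) (parent S t i) (S t i).2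
        (Function.updateFinset 0 _ y'))) *
        backwardValue M G f S (t + 1) (Function.updateFinset 0 _ y')) := fun i =>
    ((measurable_futureIntegrand h hf S hn _ _).comp measurable_updateFinset).const_mul _
  have hB : ∀ i, Measurable fun y' : (∀ _ : Finset.univ.filter (fun s : Fin T =>
      t.val + 1 ≤ s.val), Pt D) => ENNReal.ofReal (weight G S t i) *
      (ENNReal.ofReal (pathDensityFrom M G (t + 1) (attach (t + 1) (parent S t i) (S t i).2
        (Function.updateFinset 0 _ y'))) *
        backwardValue M G f S t (Function.update (Function.updateFinset 0 _ y') t (S t i).2)) :=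
    fun i => ((measurable_selectedIntegrand h hf S t).comp (measurable_const.prodMk
      measurable_updateFinset : Measurable fun y' => ((parent S t i, (S t i).2),
        Function.updateFinset (0 : Fin T → Pt D) _ y'))).const_mul _
  rw [← lintegral_finsetSum _ fun i _ => hA i, ← lintegral_finsetSum _ fun i _ => hB i]
  refine lintegral_congr fun y' => ?_
  generalize Function.updateFinset (0 : Fin T → Pt D) _ y' = y
  have hw := futureWeight_pos h S t y
  simp_rw [← mul_assoc, ← ENNReal.ofReal_mul (h.weight_pos () S t _).le]
  rw [← Finset.sum_mul, backwardValue_succ, Finset.mul_sum]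
  refine Finset.sum_congr rfl fun j _ => ?_
  rw [← mul_assoc]
  change (∑ i, ENNReal.ofReal (futureWeight M G S t y i)) * _ * _ =
    ENNReal.ofReal (futureWeight M G S t y j) * _
  rw [← ENNReal.ofReal_sum_of_nonneg fun i _ => (hw i).le,
    ← ENNReal.ofReal_mul (sum_pos_of_pos hw).le]
  congr 2
  exact mul_div_cancel₀ _ (sum_pos_of_pos hw).ne'

/-- Once the state at `t` is selected, generation `t` is no longer consulted. -/
theorem selectedIntegral_update (f : (Fin T → Pt D) → ENNReal) (S : Particles T D N) (t : Fin T)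
    (g : Fin (N + 1) → Fin (N + 1) × Pt D) (z₁ z : Pt D) :
    selectedIntegral M G f (Function.update S t g) t z₁ z = selectedIntegral M G f S t z₁ z := by
  simp only [selectedIntegral, backwardValue_update f S (le_refl t.val)]

/-- One step of the backward pass, averaged over the particles at the time of the step. -/
theorem particleStep_futureIntegral (h : Regular (fun _ : Unit => M) fun _ => G)
    {f : (Fin T → Pt D) → ENNReal} (hf : Measurable f) (S : Particles T D N) (t : Fin T) :
    particleStep M G t (fun S => ∑ i, ENNReal.ofReal (ancestorWeight G S (t + 1) i) *
        futureIntegral M G f S (t + 1) (prevParent S (t + 1) i) (prevState S (t + 1) i)) S =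
      ∑ i, ENNReal.ofReal (ancestorWeight G S t i) *
        futureIntegral M G f S t (prevParent S t i) (prevState S t i) := by
  have hK : Measurable fun p : Fin (N + 1) × Pt D =>
      selectedIntegral M G f S t (prevState S t p.1) p.2 := by
    have hs : Measurable fun p : Fin (N + 1) × Pt D => prevState S t p.1 :=
      measurable_prevState t (S := fun _ => S) measurable_const measurable_fst
    have hs' : Measurable fun p : Fin (N + 1) × Pt D => (prevState S t p.1, p.2) :=
      hs.prodMk measurable_snd
    have hsel := measurable_selectedIntegral h hf S t
    generalize selectedIntegral M G f S t = K at hsel ⊢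
    exact hsel.comp hs'
  have hK' : Measurable fun q : (Fin (N + 1) × Pt D) × (Fin (N + 1) → Fin (N + 1) × Pt D) =>
      selectedIntegral M G f S t (prevState S t q.1.1) q.1.2 :=
    hK.comp (f := fun q : (Fin (N + 1) × Pt D) × (Fin (N + 1) → Fin (N + 1) × Pt D) => q.1)
      measurable_fst
  -- Given the earlier generations, the summand `j` sees generation `t` only through particle `j`,
  -- the form required by the many-to-one formula.
  have hF : ∀ g : Fin (N + 1) → Fin (N + 1) × Pt D,
      ∑ i, ENNReal.ofReal (ancestorWeight G (Function.update S t g) (t + 1) i) *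
        futureIntegral M G f (Function.update S t g) (t + 1)
          (prevParent (Function.update S t g) (t + 1) i)
          (prevState (Function.update S t g) (t + 1) i) =
      ∑ j, ENNReal.ofReal (weight G (Function.update S t g) t j) *
        selectedIntegral M G f S t (prevState S t (g j).1) (g j).2 := fun g => by
    rw [sum_futureIntegral_succ h hf]
    refine Finset.sum_congr rfl fun j _ => ?_
    rw [parent_update_self, Function.update_self, selectedIntegral_update]
  obtain ⟨K, hKe⟩ : ∃ K, K = selectedIntegral M G f S t := ⟨_, rfl⟩
  rw [← hKe] at hK' hF
  have key := particleStep_sum_weight h t S (f := fun _ p _ => K (prevState S t p.1) p.2)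
    (fun _ => hK') (F := fun S => ∑ i, ENNReal.ofReal (ancestorWeight G S (t + 1) i) *
      futureIntegral M G f S (t + 1) (prevParent S (t + 1) i) (prevState S (t + 1) i)) hF
  rw [key]
  refine Finset.sum_congr rfl fun i _ => ?_
  rw [futureIntegral_eq h hf S t (fun ht => prevParent_eq_zero S ht i)
    (fun ht => prevState_eq_zero S ht i), ← hKe]
  congr 1
  refine lintegral_congr fun z => ?_
  have hprob : IsProbabilityMeasure (proposalLaw M G S t) :=
    (h.proposalLaw t (u := fun _ : Unit => ()) (S := fun _ => S) measurable_const
      measurable_const).isProb ()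
  have : ∀ n j : Fin (N + 1), IsProbabilityMeasure
      (if n = j then Measure.dirac (i, z) else proposalLaw M G S t) := fun n j => by
    split_ifs <;> infer_instance
  -- The integrand does not depend on the rest of the generation or on the uniform position, so both
  -- average out.
  simp_rw [lintegral_const, measure_univ, mul_one]
  rw [ofReal_uniform_mul]

/-- The left side is the same for every `n`: each step trades generation `t` for an integral over
the state at time `t`. At `n = 0` no particles remain. -/
theorem particleExpectation_futureIntegral (h : Regular (fun _ : Unit => M) fun _ => G)
    {f : (Fin T → Pt D) → ENNReal} (hf : Measurable f) {n : ℕ} (hn : n ≤ T) :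
    particleExpectation (N := N) M G n (fun S => ∑ i, ENNReal.ofReal (ancestorWeight G S n i) *
        futureIntegral M G f S n (prevParent S n i) (prevState S n i)) =
      ∫⁻ y, ENNReal.ofReal (pathDensityFrom M G 0 y) * f y := by
  induction n with
  | zero =>
    simp only [particleExpectation, ancestorWeight]
    rw [Finset.sum_eq_single 0 (fun i _ hi => by simp [hi]) (by simp)]
    have e : (Finset.univ.filter fun s : Fin T => 0 ≤ s.val) = Finset.univ := by simp
    have e' : ∀ (z₂ z₁ : Pt D) (y : Fin T → Pt D), attach 0 z₂ z₁ y = y := fun _ _ _ =>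
      funext fun s => attach_of_le _ _ _ (Nat.zero_le _)
    rw [futureIntegral, e, lmarginal_univ]
    simp only [e', backwardValue, if_true, ENNReal.ofReal_one, one_mul]
    rfl
  | succ n ih =>
    obtain ⟨t, rfl⟩ : ∃ t : Fin T, t.val = n := ⟨⟨n, hn⟩, rfl⟩
    rw [particleExpectation_succ, ← ih (by omega)]
    exact congrArg _ (funext fun S => particleStep_futureIntegral h hf S t)

theorem lintegral_csmcLaw (h : Regular (fun _ : Unit => M) fun _ => G) (hN : 1 ≤ N)
    {f : (Fin T → Pt D) → ENNReal} (hf : Measurable f) (x : Fin T → Pt D) :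
    ∫⁻ y, f y ∂csmcLaw N M G x =
      ∫⁻ s, ∫⁻ l, f (selectPath s.2 l) ∂backwardLaw M G s ∂forwardLaw N M G x := by
  have hp : MarkovFamily fun s : (Fin T → Fin (N + 1)) × Particles T D N =>
      (backwardLaw M G s).map fun l t => (s.2 t (l t)).2 :=
    h.pathLaw hN (u := fun _ => ()) measurable_const measurable_id
  rw [csmcLaw, Measure.lintegral_bind hp.measurable.aemeasurable hf.aemeasurable]
  refine lintegral_congr fun s => ?_
  rw [lintegral_map hf (measurable_of_countable _)]
  rfl

/-- Conditional sequential Monte Carlo with a forced move and backward sampling leaves the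
(unnormalised) path density invariant. -/
theorem lintegral_pathDensity_mul_csmcLaw (h : Regular (fun _ : Unit => M) fun _ => G)
    (hT : 1 ≤ T) (hN : 1 ≤ N) {f : (Fin T → Pt D) → ENNReal} (hf : Measurable f) :
    ∫⁻ x, ENNReal.ofReal (∏ t, stepDensity M G t (lag2 x t) (lag1 x t) (x t)) *
        ∫⁻ y, f y ∂csmcLaw N M G x =
      ∫⁻ x, ENNReal.ofReal (∏ t, stepDensity M G t (lag2 x t) (lag1 x t) (x t)) * f x := by
  obtain ⟨t, ht⟩ : ∃ t : Fin T, t.val + 1 = T :=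
    ⟨⟨T - 1, by omega⟩, by simp only; omega⟩
  -- the value of the backward pass, as a function of the last reference index and the particles
  set F : Fin (N + 1) × Particles T D N × Pt D × Pt D → ENNReal := fun q =>
    ∫⁻ l, f (selectPath q.2.1 l) ∂backwardLaw M G (fun _ => q.1, q.2.1) with hF
  have hFm : Measurable F := by
    refine (h.backwardLaw hN (u := fun _ => ()) measurable_const
      (s := fun q : Fin (N + 1) × Particles T D N × Pt D × Pt D => (fun _ => q.1, q.2.1))
      ((measurable_pi_lambda _ fun _ => measurable_fst).prodMk
        measurable_snd.fst)).measurable_lintegral (f := fun q l => f (selectPath q.2.1 l)) ?_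
    exact hf.comp (measurable_path (measurable_fst.snd.fst) measurable_snd)
  -- All reference indices may be replaced by the last one, so the value becomes a function of the
  -- data kept in `lmarginal_forwardPrefix`.
  have hFk : ∀ (s : (Fin T → Fin (N + 1)) × Particles T D N) (z₁ z₂ : Pt D),
      ∫⁻ l, f (selectPath s.2 l) ∂backwardLaw M G s = F (s.1 t, s.2, z₁, z₂) := fun s _ _ => by
    simp only [hF]
    rw [lintegral_backwardLaw h hN f s ht, lintegral_backwardLaw h hN f (_, _) ht]
  have e1 : (Finset.univ.filter fun s : Fin T => s.val < T) = Finset.univ := by simp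
  have e2 : (Finset.univ.filter fun s : Fin T => 0 ≤ s.val) = Finset.univ := by simp
  have hfwd := lmarginal_forwardPrefix h (N := N) le_rfl hFm
  have hbwd := particleExpectation_futureIntegral (N := N) h hf (le_refl T)
  simp only [pathDensityFrom, e2] at hbwd
  rw [← hbwd]
  simp only [e1, lmarginal_univ, pathDensityBefore, forwardPrefix_length] at hfwd
  have hL : ∀ x : Fin T → Pt D, ∫⁻ y, f y ∂csmcLaw N M G x =
      ∫⁻ s, F (prev s.1 T, s.2, prev x T, prev (lag1 x) T) ∂forwardLaw N M G x := fun x => by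
    rw [lintegral_csmcLaw h hN hf]
    refine lintegral_congr fun s => ?_
    rw [hFk s (prev x T) (prev (lag1 x) T)]
    congr 2
    have := prev_succ s.1 t
    rw [ht] at this
    exact this.symm
  simp_rw [hL]
  -- Both sides are expectations over the same weighted particle system, so it suffices to compare
  -- integrands for a fixed `S`.
  refine hfwd.trans (congrArg _ (funext fun S => ?_))
  -- the forced move and the selection at the last time
  have hT' : ∀ i, futureIntegral M G f S T (prevParent S T i) (prevState S T i) =
      backwardValue M G f S T (selectPath S 0) := fun i => by
    rw [futureIntegral, filter_le_eq_empty le_rfl, lmarginal_empty]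
    simp only [pathDensityFrom_of_le le_rfl, ENNReal.ofReal_one, one_mul]
    exact backwardValue_congr f S le_rfl fun s hs => absurd s.isLt (by omega)
  have hanc : ancestorWeight G S T = weight G S t := by
    have := ancestorWeight_succ (G := G) S t
    rwa [ht] at this
  have hval : backwardValue M G f S T (selectPath S 0) = ∑ i, ENNReal.ofReal (weight G S t i) *
      backwardValue M G f S t (Function.update (selectPath S 0) t (S t i).2) := by
    have := backwardValue_succ (M := M) (G := G) f S t (selectPath S 0)
    rwa [normalise_futureWeight_last h S ht, ht] at this
  simp_rw [hT', hanc]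
  rw [← Finset.sum_mul, ← ENNReal.ofReal_sum_of_nonneg fun i _ => (h.weight_pos () S t i).le,
    h.sum_weight () S t, ENNReal.ofReal_one, one_mul, hval]
  simp only [hF]
  simp_rw [lintegral_backwardLaw h hN f (_, S) ht]
  -- Given `S`, the index `k_T` has law `W_T`, which the forced move preserves.
  exact sum_forcedMove hN (h.weight_pos () S t) (h.sum_weight () S t) _

end Invariance

/-! ### The auxiliary algorithm -/

section Auxiliary

variable {T D N : ℕ}

/-- Joint measurability in `u` is needed only to form the kernel; the invariance of conditional SMC
is applied at one frozen `u`. -/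
theorem Regular.const {U : Type*} [MeasurableSpace U] {M : U → Fin T → Pt D → Pt D → ℝ}
    {G : U → Fin T → Pt D → Pt D → Pt D → ℝ} (h : Regular M G) (u : U) :
    Regular (fun _ : Unit => M u) fun _ => G u where
  M_meas t := (h.M_meas t).comp (f := fun p : Unit × Pt D × Pt D => (u, p.2))
    (measurable_const.prodMk measurable_snd)
  M_nonneg _ := h.M_nonneg u
  M_prob _ := h.M_prob u
  G_pos _ := h.G_pos u
  G_meas t := (h.G_meas t).comp (f := fun p : Unit × Pt D × Pt D × Pt D => (u, p.2))
    (measurable_const.prodMk measurable_snd)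
  step_pos _ := h.step_pos u

theorem measurable_section {α β γ : Type*} [MeasurableSpace α] [MeasurableSpace β]
    [MeasurableSpace γ] {F : α × β → γ} (hF : Measurable F) (a : α) :
    Measurable fun b => F (a, b) :=
  hF.comp measurable_prodMk_left

theorem measurable_unnormDensity {Q : Fin T → Pt D → Pt D → ℝ}
    (hQ : ∀ t, Measurable fun p : Pt D × Pt D => Q t p.1 p.2) : Measurable (unnormDensity Q) :=
  Finset.measurable_prod _ fun t _ =>
    (hQ t).comp ((measurable_lag1 t).prodMk (measurable_pi_apply t))

theorem targetDensity_pos {Q : Fin T → Pt D → Pt D → ℝ} (hQ : ∀ t x₁ x₂, 0 < Q t x₁ x₂)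
    (hint : Integrable (unnormDensity Q)) (x : Fin T → Pt D) : 0 < targetDensity Q x := by
  have hpos : ∀ x, 0 < unnormDensity Q x := fun x => Finset.prod_pos fun t _ => hQ t _ _
  refine div_pos (hpos x) ?_
  rw [integral_pos_iff_support_of_nonneg (fun x => (hpos x).le) hint]
  have : Function.support (unnormDensity Q) = Set.univ :=
    Set.eq_univ_of_forall fun x => (hpos x).ne'
  rw [this]
  exact isOpen_univ.measure_pos volume Set.univ_nonempty

variable {Φ : Fin T → (Fin T → Pt D) → Pt D}
  {E : Fin T → (Fin T → Pt D) → Matrix (Fin D) (Fin D) ℝ}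

theorem measurable_gaussianFactor (hΦ : ∀ t, Measurable (Φ t))
    (hE : ∀ t i j, Measurable fun x => E t x i j) (t : Fin T) :
    Measurable fun p : (Fin T → Pt D) × Pt D =>
      ENNReal.ofReal (gaussianDensity (p.1 t + Φ t p.1) (E t p.1) p.2) := by
  have hm : Measurable fun p : (Fin T → Pt D) × Pt D => p.1 t + Φ t p.1 :=
    ((measurable_pi_apply t).comp measurable_fst).add ((hΦ t).comp measurable_fst)
  exact (measurable_gaussianDensity hm (fun i j => (hE t i j).comp measurable_fst)
    measurable_snd).ennreal_ofReal

theorem markovFamily_auxLaw (hΦ : ∀ t, Measurable (Φ t)) (hE : ∀ t x, (E t x).PosDef)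
    (hEm : ∀ t i j, Measurable fun x => E t x i j) : MarkovFamily (auxLaw Φ E) := by
  refine MarkovFamily.pi fun t => ⟨?_, fun x => inferInstance⟩
  refine Measure.measurable_of_measurable_coe _ fun s hs => ?_
  simp_rw [multivariateGaussian_eq_withDensity _ (hE t _), withDensity_apply _ hs]
  exact (measurable_gaussianFactor hΦ hEm t).lintegral_prod_right'

theorem auxLaw_eq_withDensity (hΦ : ∀ t, Measurable (Φ t)) (hE : ∀ t x, (E t x).PosDef)
    (hEm : ∀ t i j, Measurable fun x => E t x i j) (x : Fin T → Pt D) :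
    auxLaw Φ E x = volume.withDensity fun u =>
      ENNReal.ofReal (∏ t, gaussianDensity (x t + Φ t x) (E t x) (u t)) := by
  have e : ∀ t, multivariateGaussian (x t + Φ t x) (E t x) = volume.withDensity fun z =>
      ENNReal.ofReal (gaussianDensity (x t + Φ t x) (E t x) z) := fun t =>
    multivariateGaussian_eq_withDensity _ (hE t x)
  have hs : ∀ t, SigmaFinite ((volume : Measure (Pt D)).withDensity fun z =>
      ENNReal.ofReal (gaussianDensity (x t + Φ t x) (E t x) z)) := fun t => by
    rw [← e t]
    infer_instance
  have hm : ∀ t, Measurable fun z =>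
      ENNReal.ofReal (gaussianDensity (x t + Φ t x) (E t x) z) := fun t =>
    measurable_section (measurable_gaussianFactor hΦ hEm t) x
  simp only [auxLaw, e]
  rw [pi_withDensity (fun _ : Fin T => (volume : Measure (Pt D))) hm, volume_pi]
  congr 1
  funext u
  exact (ENNReal.ofReal_prod_of_nonneg fun t _ => (gaussianDensity_pos _ (hE t x) _).le).symm

theorem measurable_auxDensity (hΦ : ∀ t, Measurable (Φ t))
    (hE : ∀ t i j, Measurable fun x => E t x i j) :
    Measurable fun p : (Fin T → Pt D) × (Fin T → Pt D) =>
      ∏ t, gaussianDensity (p.1 t + Φ t p.1) (E t p.1) (p.2 t) := by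
  refine Finset.measurable_prod _ fun t _ => ?_
  have hm : Measurable fun p : (Fin T → Pt D) × (Fin T → Pt D) => p.1 t + Φ t p.1 :=
    ((measurable_pi_apply t).comp measurable_fst).add ((hΦ t).comp measurable_fst)
  exact measurable_gaussianDensity hm (fun i j => (hE t i j).comp measurable_fst)
    ((measurable_pi_apply t).comp measurable_snd)

variable {M : (Fin T → Pt D) → Fin T → Pt D → Pt D → ℝ}
  {G : (Fin T → Pt D) → Fin T → Pt D → Pt D → Pt D → ℝ}

theorem Regular.auxiliaryLaw (h : Regular M G) (hN : 1 ≤ N) (hΦ : ∀ t, Measurable (Φ t))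
    (hE : ∀ t x, (E t x).PosDef) (hEm : ∀ t i j, Measurable fun x => E t x i j) :
    MarkovFamily (auxiliaryLaw N Φ E M G) :=
  (markovFamily_auxLaw hΦ hE hEm).bind (κ := fun x u => AuxCSMC.csmcLaw N (M u) (G u) x)
    (h.csmcLaw hN measurable_snd measurable_fst)

/-- Tonelli puts `u` outermost. For each `u` the conditional density of `x` is invariant under
conditional SMC, and integrating `u` out again restores the target. -/
theorem lintegral_target_auxiliaryLaw {Q : Fin T → Pt D → Pt D → ℝ} (h : Regular M G)
    (hT : 1 ≤ T) (hN : 1 ≤ N) (hQ : ∀ t x₁ x₂, 0 < Q t x₁ x₂)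
    (hQm : ∀ t, Measurable fun p : Pt D × Pt D => Q t p.1 p.2)
    (hint : Integrable (unnormDensity Q)) (hΦ : ∀ t, Measurable (Φ t))
    (hE : ∀ t x, (E t x).PosDef) (hEm : ∀ t i j, Measurable fun x => E t x i j)
    (hfac : ∀ u : Fin T → Pt D, ∃ c : ℝ, 0 < c ∧ ∀ x : Fin T → Pt D,
      extendedDensity Q Φ E x u =
        c * ∏ t, stepDensity (M u) (G u) t (lag2 x t) (lag1 x t) (x t))
    {f : (Fin T → Pt D) → ENNReal} (hf : Measurable f) :
    ∫⁻ x, ∫⁻ y, f y ∂auxiliaryLaw N Φ E M G x ∂target Q = ∫⁻ x, f x ∂target Q := by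
  have haux := markovFamily_auxLaw hΦ hE hEm
  have hP : MarkovFamily fun x => auxiliaryLaw N Φ E M G x := h.auxiliaryLaw hN hΦ hE hEm
  have htd : Measurable fun x => ENNReal.ofReal (targetDensity Q x) :=
    ((measurable_unnormDensity hQm).div_const _).ennreal_ofReal
  have htd0 : ∀ x, 0 ≤ targetDensity Q x := fun x => (targetDensity_pos hQ hint x).le
  have had := measurable_auxDensity hΦ hEm
  have hext : Measurable fun p : (Fin T → Pt D) × (Fin T → Pt D) =>
      ENNReal.ofReal (extendedDensity Q Φ E p.1 p.2) := by
    have : Measurable fun p : (Fin T → Pt D) × (Fin T → Pt D) => targetDensity Q p.1 :=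
      ((measurable_unnormDensity hQm).div_const _).comp measurable_fst
    exact (this.mul had).ennreal_ofReal
  have hC : MarkovFamily fun p : (Fin T → Pt D) × (Fin T → Pt D) =>
      csmcLaw N (M p.2) (G p.2) p.1 := h.csmcLaw hN measurable_snd measurable_fst
  have hCm : Measurable fun p : (Fin T → Pt D) × (Fin T → Pt D) =>
      ∫⁻ y, f y ∂csmcLaw N (M p.2) (G p.2) p.1 :=
    hC.measurable_lintegral (f := fun _ y => f y) (hf.comp measurable_snd)
  -- integrating out the auxiliary variables
  have hjoint : ∀ (x : Fin T → Pt D) {g : (Fin T → Pt D) → ENNReal}, Measurable g →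
      ENNReal.ofReal (targetDensity Q x) * ∫⁻ u, g u ∂auxLaw Φ E x =
        ∫⁻ u, ENNReal.ofReal (extendedDensity Q Φ E x u) * g u := fun x g hg => by
    rw [auxLaw_eq_withDensity hΦ hE hEm, lintegral_withDensity_eq_lintegral_mul _
      (measurable_section had x).ennreal_ofReal hg,
      ← lintegral_const_mul' _ _ ENNReal.ofReal_ne_top]
    refine lintegral_congr fun u => ?_
    rw [extendedDensity, ENNReal.ofReal_mul (htd0 x), mul_assoc]
    rfl
  have h1 : ∀ x, ENNReal.ofReal (targetDensity Q x) * ∫⁻ y, f y ∂auxiliaryLaw N Φ E M G x =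
      ∫⁻ u, ENNReal.ofReal (extendedDensity Q Φ E x u) *
        ∫⁻ y, f y ∂csmcLaw N (M u) (G u) x := fun x => by
    rw [auxiliaryLaw, Measure.lintegral_bind
      (measurable_section hC.measurable x).aemeasurable hf.aemeasurable]
    exact hjoint x (measurable_section hCm x)
  have h2 : ∀ x, ENNReal.ofReal (targetDensity Q x) * f x =
      ∫⁻ u, ENNReal.ofReal (extendedDensity Q Φ E x u) * f x := fun x => by
    have := haux.isProb x
    rw [← hjoint x measurable_const, lintegral_const, measure_univ, mul_one]
  rw [target, lintegral_withDensity_eq_lintegral_mul _ htd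
      (hP.measurable_lintegral (f := fun _ y => f y) (hf.comp measurable_snd)),
    lintegral_withDensity_eq_lintegral_mul _ htd hf]
  simp only [Pi.mul_apply, h1, h2]
  have hs1 := lintegral_lintegral_swap (μ := volume) (ν := volume)
    (f := fun x u => ENNReal.ofReal (extendedDensity Q Φ E x u) *
      ∫⁻ y, f y ∂csmcLaw N (M u) (G u) x) (hext.mul hCm).aemeasurable
  have hs2 := lintegral_lintegral_swap (μ := volume) (ν := volume)
    (f := fun x u => ENNReal.ofReal (extendedDensity Q Φ E x u) * f x)
    (hext.mul (hf.comp measurable_fst)).aemeasurable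
  rw [hs1, hs2]
  refine lintegral_congr fun u => ?_
  -- The constant is pulled out at fixed `u`, so its measurability in `u` plays no role.
  obtain ⟨c, hc, hcx⟩ := hfac u
  simp_rw [hcx, ENNReal.ofReal_mul hc.le, mul_assoc]
  rw [lintegral_const_mul' _ _ ENNReal.ofReal_ne_top, lintegral_const_mul' _ _ ENNReal.ofReal_ne_top,
    lintegral_pathDensity_mul_csmcLaw (h.const u) hT hN hf]

end Auxiliary

end AuxCSMC

end

/-! ### The invariance theorem -/

theorem mainTheorem4 {T D N : ℕ} (hT : 1 ≤ T) (hN : 1 ≤ N)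
    -- the factors `Q t x₁ x₂ = Q_t(x₁, x₂)` of the target distribution
    (Q : Fin T → AuxCSMC.Pt D → AuxCSMC.Pt D → ℝ)
    (hQ_pos : ∀ t x₁ x₂, 0 < Q t x₁ x₂)
    (hQ_meas : ∀ t, Measurable fun p : AuxCSMC.Pt D × AuxCSMC.Pt D => Q t p.1 p.2)
    (hQ_int : Integrable (AuxCSMC.unnormDensity Q))
    -- the shifts and the covariance matrices of the auxiliary variables
    (Φ : Fin T → (Fin T → AuxCSMC.Pt D) → AuxCSMC.Pt D)
    (hΦ_meas : ∀ t, Measurable (Φ t))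
    (E : Fin T → (Fin T → AuxCSMC.Pt D) → Matrix (Fin D) (Fin D) ℝ)
    (hE_pos : ∀ t x, (E t x).PosDef)
    (hE_meas : ∀ t i j, Measurable fun x => E t x i j)
    -- the mutation densities `M u t x₁ x₂ = M'_t(x₂ | x₁; u)`
    (M : (Fin T → AuxCSMC.Pt D) → Fin T → AuxCSMC.Pt D → AuxCSMC.Pt D → ℝ)
    (hM_nonneg : ∀ u t x₁ x₂, 0 ≤ M u t x₁ x₂)
    (hM_meas : ∀ t, Measurable
      fun p : (Fin T → AuxCSMC.Pt D) × AuxCSMC.Pt D × AuxCSMC.Pt D => M p.1 t p.2.1 p.2.2)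
    (hM_prob : ∀ u t x₁, ∫⁻ z, ENNReal.ofReal (M u t x₁ z) = 1)
    -- the potentials `G u t x₀ x₁ x₂ = G'_t(x₀, x₁, x₂; u)`
    (G : (Fin T → AuxCSMC.Pt D) → Fin T → AuxCSMC.Pt D → AuxCSMC.Pt D → AuxCSMC.Pt D → ℝ)
    (hG_pos : ∀ u t x₀ x₁ x₂, 0 < G u t x₀ x₁ x₂)
    (hG_meas : ∀ t, Measurable
      fun p : (Fin T → AuxCSMC.Pt D) × AuxCSMC.Pt D × AuxCSMC.Pt D × AuxCSMC.Pt D =>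
        G p.1 t p.2.1 p.2.2.1 p.2.2.2)
    -- given `u`, the extended target is proportional, in `x`, to the product of the `M'_t G'_t`
    (h_factor : ∀ u : Fin T → AuxCSMC.Pt D, ∃ c : ℝ, 0 < c ∧ ∀ x : Fin T → AuxCSMC.Pt D,
      AuxCSMC.extendedDensity Q Φ E x u =
        c * ∏ t, AuxCSMC.stepDensity (M u) (G u) t
          (AuxCSMC.lag2 x t) (AuxCSMC.lag1 x t) (x t)) :
    ∃ P : Kernel (Fin T → AuxCSMC.Pt D) (Fin T → AuxCSMC.Pt D),
      (∀ x, P x = AuxCSMC.auxiliaryLaw N Φ E M G x) ∧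
        IsMarkovKernel P ∧ Kernel.Invariant P (AuxCSMC.target Q) := by
  have hreg : AuxCSMC.Regular M G :=
    { M_meas := hM_meas
      M_nonneg := hM_nonneg
      M_prob := hM_prob
      G_pos := hG_pos
      G_meas := hG_meas
      -- The mutation densities are only nonnegative. Along an actual path the extended density is
      -- positive, so by the factorisation no factor can vanish.
      step_pos := fun u x t => by
        obtain ⟨c, -, hc⟩ := h_factor u
        have hpos : 0 < AuxCSMC.extendedDensity Q Φ E x u :=
          mul_pos (AuxCSMC.targetDensity_pos hQ_pos hQ_int x)
            (Finset.prod_pos fun t _ => AuxCSMC.gaussianDensity_pos _ (hE_pos t x) _)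
        rw [hc x] at hpos
        have hne := Finset.prod_ne_zero_iff.mp (right_ne_zero_of_mul hpos.ne') t (Finset.mem_univ t)
        exact lt_of_le_of_ne (mul_nonneg (hM_nonneg _ _ _ _) (hG_pos _ _ _ _ _).le) hne.symm }
  have hP := hreg.auxiliaryLaw hN hΦ_meas hE_pos hE_meas
  refine ⟨hP.kernel, fun x => rfl, hP.isMarkovKernel, Measure.ext fun s hs => ?_⟩
  rw [Measure.bind_apply hs hP.kernel.measurable.aemeasurable]
  -- Indicators as test functions turn the integral identity into equality of measures.
  have key := AuxCSMC.lintegral_target_auxiliaryLaw hreg hT hN hQ_pos hQ_meas hQ_int hΦ_meas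
    hE_pos hE_meas h_factor (measurable_one.indicator hs)
  simp only [lintegral_indicator_one hs] at key
  exact key
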